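/- Let $n\ge 0$. A $\mathcal D_n$-chart on a set $X$ is a pair $(U,k)$ of an open set $U\subset\mathbb R^n$ and a map $k:U\to X$; a morphism of charts $(U_1,k_1)\to(U_2,k_2)$ is an étale map (smooth, with invertible differential at every point) $m:U_1\to U_2$ with $k_2\circ m=k_1$. A $\mathcal D_n$-atlas is a set $\Phi$ of charts together with a category $\mathcal C_\Phi$ with objects $\Phi$, whose arrows are some morphisms of charts, such that $X$ is the colimit in sets of the domains of the charts over $\mathcal C_\Phi$. It generates the maximal atlas of all charts that locally factor through charts of $\Phi$ by étale maps, and it is full if for each chart $(V,l)$ of the maximal atlas and each $y\in V$ there are $(U,k)\in\Phi$ and a morphism of charts $m:(U,k)\to (V,l)$ with $y\in m(U)$. Let $\Phi$ be a full atlas on $X$, and let $\mathcal U$ be a cover defined by it: a base, consisting of open subsets of domains of charts, of the topology of the disjoint union of these domains. The arrows $h:U\to V$ between elements of $\mathcal U$ are the étale maps which are restrictions of arrows of $\mathcal C_\Phi$. For an open set $U\subset \mathbb R^n$ let $S(U)$ be the space of jets of infinite order at $0\in\mathbb R^n$ of regular maps $\mathbb R^n\to U$, $S'(U)=S(U)/\mathrm{GL}(n,\mathbb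 R)$, $S''(U)=S(U)/\mathrm O(n)$, and $P(U)$ the space of linear frames on $U$ (jets of order one). Let $Q$ be one of $S,S',S'',P$, and let $p:Q(U)\to U$ be the projection; each étale map $h:U\to V$ extends to $Q(h):Q(U)\to Q(V)$. Differential forms on open subsets of $Q(U)$ are smooth forms which are locally pulled back from jets of finite order. Let $\mathcal U_Q$ be the cover of $Q(X)$ with elements $Q(U)$, $U\in\mathcal U$, and arrows $Q(h)$. Let $\bar{\mathcal U}_Q$ be a complete cover of $Q(X)$ made from $\mathcal U$: its elements are open subsets $V\subset Q(U)$ with $U\in\mathcal U$ and $p(V)=U$, it contains every $Q(U)$, $U\in\mathcal U$, and it is a base of the topologies of the $Q(U)$ (for example, all such $V$); its arrows $g:V\to V'$, for $V\subset Q(U)$ and $V'\subset Q(U')$, are the restrictions of the maps $Q(h)$ for arrows $h:U\to U'$ of $\mathcal U$. For a cover $\mathcal W$ of this kind let $\check H^*_{\mathcal W}(Q(X))$ be the cohomology of the total complex, with differential $\delta+(-1)^k d$, of the double complex $$C^{k,q}_{\mathcal W}=\prod_{W_0\xrightarrow{g_1}\cdots\xrightarrow{g_k}W_k}\Omega^q(W_0),$$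 where the product is over strings of composable arrows, $d$ is the exterior derivative and $$(\delta\omega)(g_1,\dots,g_{k+1})=g_1^*\omega(g_2,\dots,g_{k+1})+\sum_{i=1}^k(-1)^i\omega(g_1,\dots,g_{i+1}g_i,\dots,g_{k+1})+(-1)^{k+1}\omega(g_1,\dots,g_k).$$ Then there is a natural isomorphism of real vector spaces $$\check H^m_{\mathcal U_Q}(Q(X))\cong\check H^m_{\bar{\mathcal U}_Q}(Q(X))\qquad\text{for all } m\ge 0 .$$ It is induced by the cochain map $\mu$, $\mu(\varphi)(g_1,\dots,g_k)=\varphi(Q(h_1),\dots,Q(h_k))|_{V_0}$, where $g_i:V_{i-1}\to V_i$ is the restriction of $Q(h_i)$; its inverse is induced by the restriction of cochains from $\bar{\mathcal U}_Q$ to the strings of arrows of $\mathcal U_Q$. It is natural in $X$: if $f:X\to Y$ is a map of sets with such atlases and covers for which $(U,k)\mapsto(U,f\circ k)$ maps the charts, the arrows of charts, the elements of the cover $\mathcal U$ and those of $\bar{\mathcal U}_Q$ for $X$ to those for $Y$, then the isomorphisms commute with the induced maps $f^*$. -/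

import Mathlib

open CategoryTheory TopologicalSpace
open scoped ContDiff Topology

universe u v

noncomputable section

namespace CechDeRham

/-- The model space `ℝⁿ`. -/
abbrev E (n : ℕ) : Type := EuclideanSpace ℝ (Fin n)

/-! ### The category `𝒟ₙ` of open subsets of `ℝⁿ` and étale maps -/

/-- A map `f : U → V` between open subsets of `ℝⁿ`, extended by zero to a map `ℝⁿ → ℝⁿ`. -/
def extendZero {n : ℕ} {U V : Opens (E n)} (f : U → V) : E n → E n :=
  Function.extend Subtype.val (fun x => (f x : E n)) 0

lemma extendZero_apply {n : ℕ} {U V : Opens (E n)} (f : U → V) (x : U) :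
    extendZero f x = f x :=
  Subtype.val_injective.extend_apply _ _ x

/-- An étale (regular) map `U → V`: a smooth map whose differential is invertible at each point. -/
@[ext]
structure EtaleMap {n : ℕ} (U V : Opens (E n)) where
  toFun : U → V
  contDiffOn : ContDiffOn ℝ ∞ (extendZero toFun) U
  regular : ∀ x ∈ U, (fderiv ℝ (extendZero toFun) x).IsInvertible

namespace EtaleMap

variable {n : ℕ} {U V W : Opens (E n)}

lemma contDiffAt (h : EtaleMap U V) {x : E n} (hx : x ∈ U) :
    ContDiffAt ℝ ∞ (extendZero h.toFun) x :=
  h.contDiffOn.contDiffAt (U.isOpen.mem_nhds hx)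

/-- The inclusion of a smaller open set. -/
def incl (hUV : U ≤ V) : EtaleMap U V where
  toFun x := ⟨x, hUV x.2⟩
  contDiffOn := contDiffOn_id.congr fun x hx => extendZero_apply _ ⟨x, hx⟩
  regular x hx := by
    have : extendZero (fun x : U => (⟨x, hUV x.2⟩ : V)) =ᶠ[𝓝 x] id :=
      Filter.eventually_of_mem (U.isOpen.mem_nhds hx) fun y hy => extendZero_apply _ ⟨y, hy⟩
    rw [this.fderiv_eq, fderiv_id]
    exact ⟨ContinuousLinearEquiv.refl ℝ (E n), rfl⟩

lemma extendZero_comp (g : V → W) (f : U → V) {x : E n} (hx : x ∈ U) :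
    extendZero (g ∘ f) x = (extendZero g ∘ extendZero f) x := by
  have h1 := extendZero_apply (g ∘ f) ⟨x, hx⟩
  have h2 := extendZero_apply f ⟨x, hx⟩
  simp only [Function.comp_apply] at h1 h2 ⊢
  rw [h1, h2, extendZero_apply]

lemma extendZero_mem (f : U → V) {x : E n} (hx : x ∈ U) : extendZero f x ∈ V := by
  rw [extendZero_apply f ⟨x, hx⟩]; exact (f ⟨x, hx⟩).2

/-- Composition of étale maps. -/
def comp (f : EtaleMap U V) (g : EtaleMap V W) : EtaleMap U W where
  toFun := g.toFun ∘ f.toFun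
  contDiffOn := (g.contDiffOn.comp f.contDiffOn fun _ hx => extendZero_mem _ hx).congr
    fun _ hx => extendZero_comp _ _ hx
  regular x hx := by
    have : extendZero (g.toFun ∘ f.toFun) =ᶠ[𝓝 x] extendZero g.toFun ∘ extendZero f.toFun :=
      Filter.eventually_of_mem (U.isOpen.mem_nhds hx) fun y hy => extendZero_comp _ _ hy
    have hfx := extendZero_mem f.toFun hx
    rw [this.fderiv_eq, fderiv_comp x ((g.contDiffAt hfx).differentiableAt (by simp))
      ((f.contDiffAt hx).differentiableAt (by simp))]
    exact (g.regular _ hfx).comp (f.regular x hx)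

end EtaleMap

/-- The category `𝒟ₙ`: its objects are the open subsets of `ℝⁿ`. -/
structure Dn (n : ℕ) where
  carrier : Opens (E n)

instance (n : ℕ) : Category.{0} (Dn n) where
  Hom U V := EtaleMap U.carrier V.carrier
  id _ := EtaleMap.incl le_rfl
  comp f g := EtaleMap.comp f g

/-! ### Spaces with plots and their differential forms

A manifold modelled on a projective limit of finite-dimensional spaces (such as `ℝ^∞`) is recorded
by its topology, by its smooth maps `ℝᵐ → X` (plots), and by the relations "the two points have the
same image in the `k`-th finite-dimensional stage".  A differential form is given by its pullbacks
along all plots; it is required to be, locally, the pullback of a form from a finite stage. -/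

/-- A space together with its topology, its plots `ℝᵐ → X`, and the relations `Agree k`:
"the points have the same image in the `k`-th finite-dimensional stage". -/
structure PlotSpace where
  carrier : Type
  top : TopologicalSpace carrier
  IsPlot : ∀ m : ℕ, (E m → carrier) → Prop
  isPlot_comp : ∀ {m m' : ℕ} {p : E m → carrier} {φ : E m' → E m},
    IsPlot m p → ContDiff ℝ ∞ φ → IsPlot m' (p ∘ φ)
  Agree : ℕ → carrier → carrier → Prop
  agree_mono : ∀ {k k' : ℕ} {x y : carrier}, k ≤ k' → Agree k' x y → Agree k x y

attribute [instance] PlotSpace.top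

namespace PlotSpace

/-- The plots `ℝᵐ → X`. -/
def Plot (X : PlotSpace) (m : ℕ) : Type := {p : E m → X.carrier // X.IsPlot m p}

/-- Reparametrization of a plot by a smooth map. -/
def Plot.comp {X : PlotSpace} {m m' : ℕ} (p : X.Plot m) (φ : E m' → E m)
    (hφ : ContDiff ℝ ∞ φ) : X.Plot m' :=
  ⟨p.1 ∘ φ, X.isPlot_comp p.2 hφ⟩

/-- Smooth maps: continuous maps that preserve plots and are compatible with the finite stages. -/
@[ext]
structure Map (X Y : PlotSpace) where
  toFun : X.carrier → Y.carrier
  continuous : Continuous toFun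
  isPlot : ∀ {m : ℕ} {p : E m → X.carrier}, X.IsPlot m p → Y.IsPlot m (toFun ∘ p)
  agree : ∀ {k : ℕ} {x y : X.carrier}, X.Agree k x y → Y.Agree k (toFun x) (toFun y)

instance : Category.{0} PlotSpace where
  Hom X Y := Map X Y
  id X := ⟨id, continuous_id, fun h => h, fun h => h⟩
  comp f g := ⟨g.toFun ∘ f.toFun, g.continuous.comp f.continuous, fun h => g.isPlot (f.isPlot h),
    fun h => g.agree (f.agree h)⟩

/-- The image of a plot under a smooth map. -/
def Plot.map {X Y : PlotSpace} {m : ℕ} (p : X.Plot m) (f : X ⟶ Y) : Y.Plot m :=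
  ⟨f.toFun ∘ p.1, f.isPlot p.2⟩

/-- The open subspace on an open subset `V` of `X`. -/
def restrict (X : PlotSpace) (V : Opens X.carrier) : PlotSpace where
  carrier := V
  top := inferInstance
  IsPlot m p := X.IsPlot m (fun t => (p t : X.carrier))
  isPlot_comp hp hφ := X.isPlot_comp hp hφ
  Agree k x y := X.Agree k x y
  agree_mono hk h := X.agree_mono hk h

/-- The inclusion `V → X` of an open subset. -/
def inclusion (X : PlotSpace) (V : Opens X.carrier) : X.restrict V ⟶ X where
  toFun := Subtype.val
  continuous := continuous_subtype_val
  isPlot h := h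
  agree h := h

/-- The identification of `X` with its open subset `X`. -/
def toRestrictTop (X : PlotSpace) (V : Opens X.carrier) (hV : V = ⊤) : X ⟶ X.restrict V where
  toFun x := ⟨x, hV ▸ trivial⟩
  continuous := continuous_id.subtype_mk _
  isPlot h := h
  agree h := h

/-- The restriction `V → W` of a smooth map `f : X → Y` with `f(V) ⊆ W`. -/
def restrictMap {X Y : PlotSpace} (f : X ⟶ Y) (V : Opens X.carrier) (W : Opens Y.carrier)
    (h : ∀ x ∈ V, f.toFun x ∈ W) : X.restrict V ⟶ Y.restrict W where
  toFun := fun x : V => ⟨f.toFun x, h x x.2⟩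
  continuous := (f.continuous.comp continuous_subtype_val).subtype_mk _
  isPlot hp := f.isPlot hp
  agree ha := f.agree ha

end PlotSpace

/-- A smooth differential `q`-form on `X`: a compatible family of smooth forms `α m p` on the
domains `ℝᵐ` of all plots `p` of `X` which, locally on `X`, depends only on the image of the plot
in some finite-dimensional stage. -/
structure IsForm (q : ℕ) (X : PlotSpace)
    (α : ∀ m : ℕ, X.Plot m → E m → E m [⋀^Fin q]→L[ℝ] ℝ) : Prop where
  smooth : ∀ m (p : X.Plot m), ContDiff ℝ ∞ (α m p)
  compat : ∀ m m' (p : X.Plot m) (φ : E m' → E m) (hφ : ContDiff ℝ ∞ φ) (t : E m'),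
    α m' (p.comp φ hφ) t = (α m p (φ t)).compContinuousLinearMap (fderiv ℝ φ t)
  finiteOrder : ∀ x : X.carrier, ∃ N : Opens X.carrier, x ∈ N ∧ ∃ k : ℕ, ∀ m (p p' : X.Plot m),
    (∀ t, p.1 t ∈ N) → (∀ t, p'.1 t ∈ N) → (∀ t, X.Agree k (p.1 t) (p'.1 t)) → α m p = α m p'

/-- The smooth differential `q`-forms on `X`, as a subspace of all families of forms on plots. -/
def formSubmodule (q : ℕ) (X : PlotSpace) :
    Submodule ℝ (∀ m : ℕ, X.Plot m → E m → E m [⋀^Fin q]→L[ℝ] ℝ) where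
  carrier := {α | IsForm q X α}
  zero_mem' :=
    { smooth := fun _ _ => contDiff_const
      compat := fun _ _ _ _ _ _ => rfl
      finiteOrder := fun _ => ⟨⊤, trivial, 0, fun _ _ _ _ _ _ => rfl⟩ }
  add_mem' := by
    intro α β hα hβ
    refine ⟨fun m p => (hα.smooth m p).add (hβ.smooth m p), fun m m' p φ hφ t => ?_, fun x => ?_⟩
    · have h1 := hα.compat m m' p φ hφ t
      have h2 := hβ.compat m m' p φ hφ t
      simp only [Pi.add_apply, h1, h2]
      rfl
    · obtain ⟨N, hN, k, hk⟩ := hα.finiteOrder x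
      obtain ⟨N', hN', k', hk'⟩ := hβ.finiteOrder x
      exact ⟨N ⊓ N', ⟨hN, hN'⟩, max k k', fun m p p' hp hp' ha => by
        simp only [Pi.add_apply]
        rw [hk m p p' (fun t => (hp t).1) (fun t => (hp' t).1)
            (fun t => X.agree_mono (le_max_left _ _) (ha t)),
          hk' m p p' (fun t => (hp t).2) (fun t => (hp' t).2)
            (fun t => X.agree_mono (le_max_right _ _) (ha t))]⟩
  smul_mem' := by
    intro c α hα
    refine ⟨fun m p => (hα.smooth m p).const_smul c, fun m m' p φ hφ t => ?_, fun x => ?_⟩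
    · have h1 := hα.compat m m' p φ hφ t
      simp only [Pi.smul_apply, h1]
      rfl
    · obtain ⟨N, hN, k, hk⟩ := hα.finiteOrder x
      exact ⟨N, hN, k, fun m p p' hp hp' ha => by simp only [Pi.smul_apply, hk m p p' hp hp' ha]⟩

/-- The vector space `Ω^q(X)` of smooth differential `q`-forms on `X`. -/
def Form (q : ℕ) (X : PlotSpace) : Type := formSubmodule q X

instance (q : ℕ) (X : PlotSpace) : AddCommGroup (Form q X) :=
  inferInstanceAs (AddCommGroup (formSubmodule q X))

instance (q : ℕ) (X : PlotSpace) : Module ℝ (Form q X) :=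
  inferInstanceAs (Module ℝ (formSubmodule q X))

namespace Form

@[ext]
lemma ext {q : ℕ} {X : PlotSpace} {α β : Form q X} (h : ∀ m p t, α.1 m p t = β.1 m p t) : α = β :=
  Subtype.ext (funext fun m => funext fun p => funext fun t => h m p t)

variable {q : ℕ} {X Y Z : PlotSpace}

/-- The pullback `f^* : Ω^q(Y) → Ω^q(X)` along a smooth map `f : X → Y`. -/
def pullback (f : X ⟶ Y) : Form q Y →ₗ[ℝ] Form q X where
  toFun α := ⟨fun m p => α.1 m (p.map f),
    { smooth := fun m p => α.2.smooth m (p.map f)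
      compat := fun m m' p φ hφ t => α.2.compat m m' (p.map f) φ hφ t
      finiteOrder := fun x => by
        obtain ⟨N, hN, k, hk⟩ := α.2.finiteOrder (f.toFun x)
        exact ⟨⟨f.toFun ⁻¹' N, N.isOpen.preimage f.continuous⟩, hN, k, fun m p p' hp hp' ha =>
          hk m (p.map f) (p'.map f) hp hp' fun t => f.agree (ha t)⟩ }⟩
  map_add' _ _ := rfl
  map_smul' _ _ := rfl

/-- The exterior derivative `d : Ω^q(X) → Ω^{q+1}(X)`, computed on each plot. -/
def d : Form q X →ₗ[ℝ] Form (q + 1) X where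
  toFun α := ⟨fun m p => extDeriv (α.1 m p),
    { smooth := fun m p => by
        have h : ContDiff ℝ ∞ (fderiv ℝ (α.1 m p)) := (α.2.smooth m p).fderiv_right (by simp)
        exact (ContinuousAlternatingMap.alternatizeUncurryFinCLM ℝ (E m) ℝ).contDiff.comp h
      compat := fun m m' p φ hφ t => by
        have h : α.1 m' (p.comp φ hφ) = fun t =>
            (α.1 m p (φ t)).compContinuousLinearMap (fderiv ℝ φ t) :=
          funext fun t => α.2.compat m m' p φ hφ t
        rw [h]
        exact extDeriv_pullback (r := ∞) ((α.2.smooth m p).differentiable (by simp) _)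
          hφ.contDiffAt (by rw [minSmoothness_of_isRCLikeNormedField]; exact WithTop.coe_le_coe.2 le_top)
      finiteOrder := fun x => by
        obtain ⟨N, hN, k, hk⟩ := α.2.finiteOrder x
        exact ⟨N, hN, k, fun m p p' hp hp' ha => by rw [hk m p p' hp hp' ha]⟩ }⟩
  map_add' α β := by
    ext m p t : 1
    exact extDeriv_add ((α.2.smooth m p).differentiable (by simp) t)
      ((β.2.smooth m p).differentiable (by simp) t)
  map_smul' c α := by
    ext m p t : 1
    exact extDeriv_smul c (α.1 m p)

lemma d_d (α : Form q X) : d (d α) = 0 := by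
  ext m p t : 1
  exact congrFun (extDeriv_extDeriv (α.2.smooth m p) (by rw [minSmoothness_of_isRCLikeNormedField]; exact WithTop.coe_le_coe.2 le_top)) t

lemma d_pullback (f : X ⟶ Y) (α : Form q Y) : d (pullback f α) = pullback f (d α) := rfl

lemma pullback_id (α : Form q X) : pullback (𝟙 X) α = α := rfl

lemma pullback_comp (f : X ⟶ Y) (g : Y ⟶ Z) (α : Form q Z) :
    pullback (f ≫ g) α = pullback f (pullback g α) := rfl

end Form

/-! ### The Čech–de Rham complex of a diagram of spaces -/

section Complex

variable {C : Type u} [Category.{0} C] (F : C ⥤ PlotSpace)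

/-- The space `C^{p,q} = ∏ Ω^q(F(U₀))`, the product over all strings of composable arrows
`U₀ → U₁ → ⋯ → U_p` of `C`. -/
def Cochain (p q : ℕ) : Type u := ∀ s : ComposableArrows C p, Form q (F.obj (s.obj 0))

instance (p q : ℕ) : AddCommGroup (Cochain F p q) :=
  inferInstanceAs (AddCommGroup (∀ s : ComposableArrows C p, Form q (F.obj (s.obj 0))))

instance (p q : ℕ) : Module ℝ (Cochain F p q) :=
  inferInstanceAs (Module ℝ (∀ s : ComposableArrows C p, Form q (F.obj (s.obj 0))))

/-- The value of a cochain on a string. -/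
def Cochain.eval {p : ℕ} (q : ℕ) (s : ComposableArrows C p) :
    Cochain F p q →ₗ[ℝ] Form q (F.obj (s.obj 0)) where
  toFun α := α s
  map_add' _ _ := rfl
  map_smul' _ _ := rfl

/-- A linear map to cochains, given by its values on all strings. -/
def Cochain.lift {p q : ℕ} {M : Type*} [AddCommGroup M] [Module ℝ M]
    (f : ∀ s : ComposableArrows C p, M →ₗ[ℝ] Form q (F.obj (s.obj 0))) :
    M →ₗ[ℝ] Cochain F p q where
  toFun x s := f s x
  map_add' x y := funext fun s => (f s).map_add x y
  map_smul' c x := funext fun s => (f s).map_smul c x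

/-- The `i`-th face of a string `(h₁, …, h_{p+1})`, which omits the object `Uᵢ`: it is
`(h₂, …, h_{p+1})` for `i = 0`, `(h₁, …, h_{i+1} ∘ hᵢ, …, h_{p+1})` for `0 < i < p + 1`, and
`(h₁, …, h_p)` for `i = p + 1`. -/
def face {p : ℕ} (i : Fin (p + 2)) (s : ComposableArrows C (p + 1)) : ComposableArrows C p :=
  s.whiskerLeft (Fin.strictMono_succAbove i).monotone.functor

/-- The arrow from the first object `U₀` of a string to the first object of its `i`-th face: it is
`h₁ : U₀ → U₁` for `i = 0` and the identity of `U₀` for `i > 0`. -/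
def faceArrow {p : ℕ} (i : Fin (p + 2)) (s : ComposableArrows C (p + 1)) :
    s.obj 0 ⟶ (face i s).obj 0 :=
  s.map (homOfLE (Fin.zero_le _))

/-- The horizontal differential `δ : C^{p,q} → C^{p+1,q}`,
`(δα)(h₁, …, h_{p+1}) = h₁^* α(h₂, …, h_{p+1}) + ∑ᵢ (-1)^i α(h₁, …, h_{i+1} ∘ hᵢ, …, h_{p+1})
  + (-1)^{p+1} α(h₁, …, h_p)`. -/
def delta (p q : ℕ) : Cochain F p q →ₗ[ℝ] Cochain F (p + 1) q :=
  Cochain.lift F fun s => ∑ i : Fin (p + 2),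
    ((-1 : ℝ) ^ (i : ℕ)) • (Form.pullback (F.map (faceArrow i s))).comp (Cochain.eval F q (face i s))

/-- The de Rham differential on `C^{p,q}`. -/
def deRham (p q : ℕ) : Cochain F p q →ₗ[ℝ] Cochain F p (q + 1) :=
  Cochain.lift F fun s => Form.d.comp (Cochain.eval F q s)

/-- The total space `⨁_{p+q=m} C^{p,q}`. -/
def Tot (m : ℕ) : Type u := ∀ x : {x : ℕ × ℕ // x.1 + x.2 = m}, Cochain F x.1.1 x.1.2

instance (m : ℕ) : AddCommGroup (Tot F m) :=
  inferInstanceAs (AddCommGroup (∀ x : {x : ℕ × ℕ // x.1 + x.2 = m}, Cochain F x.1.1 x.1.2))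

instance (m : ℕ) : Module ℝ (Tot F m) :=
  inferInstanceAs (Module ℝ (∀ x : {x : ℕ × ℕ // x.1 + x.2 = m}, Cochain F x.1.1 x.1.2))

/-- The projection of the total space to its summand `C^{p,q}`. -/
def Tot.proj (m p q : ℕ) (h : p + q = m) : Tot F m →ₗ[ℝ] Cochain F p q where
  toFun α := α ⟨(p, q), h⟩
  map_add' _ _ := rfl
  map_smul' _ _ := rfl

/-- A linear map to the total space, given by its components. -/
def Tot.lift {m : ℕ} {M : Type*} [AddCommGroup M] [Module ℝ M]
    (f : ∀ p q : ℕ, p + q = m → (M →ₗ[ℝ] Cochain F p q)) : M →ₗ[ℝ] Tot F m where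
  toFun a x := f x.1.1 x.1.2 x.2 a
  map_add' a b := funext fun x => (f x.1.1 x.1.2 x.2).map_add a b
  map_smul' c a := funext fun x => (f x.1.1 x.1.2 x.2).map_smul c a

/-- The component in `C^{p,q}` of `δ : Tot^m → Tot^{m+1}`. -/
def horizontal (m : ℕ) : ∀ p q : ℕ, p + q = m + 1 → (Tot F m →ₗ[ℝ] Cochain F p q)
  | 0, _, _ => 0
  | p + 1, q, h => (delta F p q).comp (Tot.proj F m p q (by omega))

/-- The component in `C^{p,q}` of the vertical differential `(-1)^p d : Tot^m → Tot^{m+1}`. -/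
def vertical (m : ℕ) : ∀ p q : ℕ, p + q = m + 1 → (Tot F m →ₗ[ℝ] Cochain F p q)
  | _, 0, _ => 0
  | p, q + 1, h => ((-1 : ℝ) ^ p) • (deRham F p q).comp (Tot.proj F m p q (by omega))

/-- The total differential `D = δ + (-1)^p d`. -/
def totD (m : ℕ) : Tot F m →ₗ[ℝ] Tot F (m + 1) :=
  Tot.lift F fun p q h => horizontal F m p q h + vertical F m p q h

lemma delta_apply {p q : ℕ} (α : Cochain F p q) (s : ComposableArrows C (p + 1)) :
    delta F p q α s = ∑ i : Fin (p + 2),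
      ((-1 : ℝ) ^ (i : ℕ)) • Form.pullback (F.map (faceArrow i s)) (α (face i s)) := by
  simp only [delta, Cochain.lift, LinearMap.coe_mk, LinearMap.sum_apply,
    LinearMap.smul_apply, LinearMap.comp_apply]
  rfl

lemma sum_sum_succAbove {M : Type*} [AddCommGroup M] [Module ℝ M] {p : ℕ}
    (f : (Fin (p + 1) →o Fin (p + 3)) → M) :
    ∑ i : Fin (p + 3), ∑ j : Fin (p + 2), ((-1 : ℝ) ^ ((i : ℕ) + (j : ℕ))) •
      f ((Fin.succAboveOrderEmb i).toOrderHom.comp (Fin.succAboveOrderEmb j).toOrderHom) = 0 := by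
  rw [← Finset.sum_product', Finset.univ_product_univ]
  have key : ∀ x : Fin (p + 3) × Fin (p + 2),
      (-1 : ℝ) ^ (((x.1.succAbove x.2 : Fin (p + 3)) : ℕ) + (x.2.predAbove x.1 : ℕ)) =
        -(-1) ^ ((x.1 : ℕ) + (x.2 : ℕ)) := fun x => Fin.neg_one_pow_succAbove_add_predAbove x.1 x.2
  refine Finset.sum_involution (fun x _ => (x.1.succAbove x.2, x.2.predAbove x.1)) ?_ ?_ ?_ ?_
  · intro x _
    have : (Fin.succAboveOrderEmb (x.1.succAbove x.2)).toOrderHom.comp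
        (Fin.succAboveOrderEmb (x.2.predAbove x.1)).toOrderHom =
        (Fin.succAboveOrderEmb x.1).toOrderHom.comp (Fin.succAboveOrderEmb x.2).toOrderHom := by
      ext k : 2
      exact Fin.succAbove_succAbove_succAbove_predAbove x.1 x.2 k
    simp only [this, key, neg_smul, add_neg_cancel]
  · intro x _ _ h
    exact Fin.succAbove_ne x.1 x.2 (congrArg Prod.fst h)
  · intro x _
    exact Finset.mem_univ _
  · intro x _
    exact Prod.ext (Fin.succAbove_succAbove_predAbove x.1 x.2)
      (Fin.predAbove_predAbove_succAbove x.1 x.2)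

lemma delta_delta {p q : ℕ} (α : Cochain F p q) :
    delta F (p + 1) q (delta F p q α) = 0 := by
  funext s
  have h := sum_sum_succAbove fun θ : Fin (p + 1) →o Fin (p + 3) =>
    Form.pullback (q := q) (F.map (s.map (homOfLE (Fin.zero_le (θ 0)))))
      (α (s.whiskerLeft θ.monotone.functor))
  rw [delta_apply]
  simp only [delta_apply, map_sum, map_smul, Finset.smul_sum, smul_smul, ← pow_add,
    ← Form.pullback_comp, ← Functor.map_comp]
  refine Eq.trans ?_ h
  refine Finset.sum_congr rfl fun i _ => Finset.sum_congr rfl fun j _ => ?_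
  congr 1
  have : faceArrow i s ≫ faceArrow j (face i s) =
      s.map (homOfLE (Fin.zero_le (i.succAbove (j.succAbove 0)))) := by
    exact (s.map_comp _ _).symm
  rw [this]
  rfl

lemma deRham_deRham {p q : ℕ} (α : Cochain F p q) :
    deRham F p (q + 1) (deRham F p q α) = 0 :=
  funext fun s => Form.d_d (α s)

lemma delta_deRham {p q : ℕ} (α : Cochain F p q) :
    delta F p (q + 1) (deRham F p q α) = deRham F (p + 1) q (delta F p q α) := by
  funext s
  change _ = Form.d (delta F p q α s)
  simp only [delta_apply, map_sum, map_smul, Form.d_pullback]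
  rfl

lemma delta_horizontal {m p q : ℕ} (h : p + q = m + 1) (α : Tot F m) :
    delta F p q (horizontal F m p q h α) = 0 := by
  rcases p with - | p
  · exact map_zero _
  · exact delta_delta F _

lemma deRham_vertical {m p q : ℕ} (h : p + q = m + 1) (α : Tot F m) :
    deRham F p q (vertical F m p q h α) = 0 := by
  rcases q with - | q
  · exact map_zero _
  · change deRham F p (q + 1) (((-1 : ℝ) ^ p) • deRham F p q _) = 0
    rw [map_smul, deRham_deRham, smul_zero]

lemma totD_totD_aux {p q : ℕ} (x : Cochain F p (q + 1)) (y : Cochain F (p + 1) q)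
    (z : Cochain F p q) (hx : delta F p (q + 1) x = 0) (hy : deRham F (p + 1) q y = 0) :
    delta F p (q + 1) (x + ((-1 : ℝ) ^ p) • deRham F p q z) +
      ((-1 : ℝ) ^ (p + 1)) • deRham F (p + 1) q (delta F p q z + y) = 0 := by
  rw [map_add, map_add, hx, hy, map_smul, delta_deRham, zero_add, add_zero, pow_succ,
    mul_neg_one]
  rw [neg_smul, add_neg_cancel]

lemma totD_totD (m : ℕ) (α : Tot F m) : totD F (m + 1) (totD F m α) = 0 := by
  funext ⟨⟨p, q⟩, h⟩
  change horizontal F (m + 1) p q h (totD F m α) + vertical F (m + 1) p q h (totD F m α) = 0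
  rcases p with - | p <;> rcases q with - | q
  · exact add_zero _
  · have hq : 0 + q = m + 1 := by omega
    change 0 + ((-1 : ℝ) ^ 0) • deRham F 0 q (0 + vertical F m 0 q hq α) = 0
    rw [zero_add (vertical F m 0 q hq α), deRham_vertical, smul_zero, zero_add]
  · have hp : p + 0 = m + 1 := by omega
    change delta F p 0 (horizontal F m p 0 hp α + 0) + 0 = 0
    rw [add_zero (horizontal F m p 0 hp α), delta_horizontal, add_zero]
  · have h1 : p + (q + 1) = m + 1 := by omega
    have h2 : p + 1 + q = m + 1 := by omega
    have h3 : p + q = m := by omega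
    exact totD_totD_aux F _ _ (α ⟨(p, q), h3⟩) (delta_horizontal F h1 α) (deRham_vertical F h2 α)

/-- The Čech–de Rham complex: the total complex of the double complex `C^{p,q}`. -/
def cechDeRham {C : Type u} [Category.{0} C] (F : C ⥤ PlotSpace) :
    CochainComplex (ModuleCat.{u} ℝ) ℕ :=
  CochainComplex.of (fun m => ModuleCat.of ℝ (Tot F m)) (fun m => ModuleCat.ofHom (totD F m))
    fun m => by
      ext1
      exact LinearMap.ext fun α => totD_totD F m α

/-- The `m`-th cohomology of the Čech–de Rham complex. -/
abbrev cechDeRhamCohomology {C : Type u} [Category.{0} C] (F : C ⥤ PlotSpace) (m : ℕ) :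
    ModuleCat.{u} ℝ :=
  (cechDeRham F).homology m

section Pullback

variable {F} {C' : Type u} [Category.{0} C'] {F' : C' ⥤ PlotSpace} (G : C ⥤ C') (τ : F ⟶ G ⋙ F')

/-- The pullback of cochains `C^{p,q}(F') → C^{p,q}(F)`,
`α ↦ ((h₁, …, h_p) ↦ τ^* α(G h₁, …, G h_p))`. -/
def cochainPullback (p q : ℕ) : Cochain F' p q →ₗ[ℝ] Cochain F p q :=
  Cochain.lift F fun s => (Form.pullback (τ.app (s.obj 0))).comp
    (Cochain.eval F' q (s ⋙ G : Fin (p + 1) ⥤ C'))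

/-- The pullback on total spaces. -/
def totPullback (m : ℕ) : Tot F' m →ₗ[ℝ] Tot F m :=
  Tot.lift F fun p q h => (cochainPullback G τ p q).comp (Tot.proj F' m p q h)

lemma cochainPullback_delta {p q : ℕ} (α : Cochain F' p q) :
    delta F p q (cochainPullback G τ p q α) = cochainPullback G τ (p + 1) q (delta F' p q α) := by
  funext s
  change _ = Form.pullback (Y := F'.obj (G.obj (s.obj 0))) (τ.app (s.obj 0))
    (delta F' p q α (s ⋙ G : Fin (p + 2) ⥤ C'))
  simp only [delta_apply, map_sum, map_smul, ← Form.pullback_comp]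
  refine Finset.sum_congr rfl fun i _ => ?_
  congr 1
  change Form.pullback _ (Form.pullback _ _) = _
  rw [← Form.pullback_comp, τ.naturality]
  rfl

lemma totPullback_totD (m : ℕ) (α : Tot F' m) :
    totD F m (totPullback G τ m α) = totPullback G τ (m + 1) (totD F' m α) := by
  funext ⟨⟨p, q⟩, h⟩
  change horizontal F m p q h _ + vertical F m p q h _ =
    cochainPullback G τ p q (horizontal F' m p q h α + vertical F' m p q h α)
  rw [map_add]
  congr 1
  · rcases p with - | p
    · exact (map_zero _).symm
    · exact cochainPullback_delta G τ _
  · rcases q with - | q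
    · exact (map_zero _).symm
    · exact ((cochainPullback G τ p (q + 1)).map_smul ((-1 : ℝ) ^ p) (deRham F' p q _)).symm

/-- The map of Čech–de Rham complexes induced by a functor `G : C → C'` together with a natural
family of smooth maps `F(U) → F'(G(U))`. -/
def cechDeRhamMap : cechDeRham F' ⟶ cechDeRham F :=
  CochainComplex.ofHom (fun m => ModuleCat.ofHom (totPullback G τ m)) fun m => by
    simp only [cechDeRham, CochainComplex.of_d]
    ext1
    exact LinearMap.ext fun α => totPullback_totD G τ m α

end Pullback

end Complex

/-! ### Jets and the frame functors -/

/-- A map `ℝⁿ → U` defined, smooth and regular near `0 ∈ ℝⁿ`. -/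
structure RegularGerm {n : ℕ} (U : Opens (E n)) where
  toFun : E n → E n
  smooth : ∀ᶠ x in 𝓝 0, ContDiffAt ℝ ∞ toFun x
  regular : (fderiv ℝ toFun 0).IsInvertible
  mem : toFun 0 ∈ U

/-- Two germs have the same jet of infinite order if all their derivatives at `0` agree. -/
instance jetSetoid {n : ℕ} (U : Opens (E n)) : Setoid (RegularGerm U) where
  r f g := ∀ k : ℕ, iteratedFDeriv ℝ k f.toFun 0 = iteratedFDeriv ℝ k g.toFun 0
  iseqv := ⟨fun _ _ => rfl, fun h k => (h k).symm, fun h h' k => (h k).trans (h' k)⟩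

/-- The space of jets of infinite order at `0 ∈ ℝⁿ` of regular maps `ℝⁿ → U`, i.e. the frames of
infinite order on `U`. -/
def Jet {n : ℕ} (U : Opens (E n)) : Type := Quotient (jetSetoid U)

namespace Jet

variable {n : ℕ} {U V W : Opens (E n)}

/-- The `k`-th derivative at `0` of a jet. -/
def coeff (k : ℕ) : Jet U → E n [×k]→L[ℝ] E n :=
  Quotient.lift (fun f => iteratedFDeriv ℝ k f.toFun 0) fun _ _ h => h k

/-- The value at `0` of a jet. -/
def base : Jet U → U :=
  Quotient.lift (fun f => ⟨f.toFun 0, f.mem⟩) fun f g h => Subtype.ext <| by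
    simpa using congrArg (fun a => a (fun _ => 0)) (h 0)

lemma coeff_zero_apply (x : Jet U) (v : Fin 0 → E n) : x.coeff 0 v = x.base := by
  induction x using Quotient.inductionOn
  exact iteratedFDeriv_zero_apply v

lemma ext_coeff {x y : Jet U} (h : ∀ k, x.coeff k = y.coeff k) : x = y := by
  induction x using Quotient.inductionOn
  induction y using Quotient.inductionOn
  exact Quotient.sound h

/-- The topology of the projective limit of the spaces of jets of finite order: the coarsest
topology in which all derivatives are continuous. -/
instance : TopologicalSpace (Jet U) := ⨅ k : ℕ, TopologicalSpace.induced (coeff k) inferInstance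

lemma continuous_coeff (k : ℕ) : Continuous (coeff k : Jet U → _) :=
  continuous_iInf_dom (i := k) continuous_induced_dom

lemma continuous_base : Continuous (base : Jet U → U) := by
  refine Continuous.subtype_mk (f := fun x => ((base x : U) : E n)) ?_ _
  simp_rw [← fun x : Jet U => coeff_zero_apply x 0]
  exact (ContinuousMultilinearMap.apply ℝ (fun _ : Fin 0 => E n) (E n) 0).continuous.comp
    (continuous_coeff 0)

/-- The composition of germs. -/
def _root_.CechDeRham.RegularGerm.comp (h : EtaleMap U V) (f : RegularGerm U) : RegularGerm V where
  toFun := extendZero h.toFun ∘ f.toFun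
  smooth := by
    have hc : ContinuousAt f.toFun 0 := f.smooth.self_of_nhds.continuousAt
    filter_upwards [f.smooth, hc.eventually (U.isOpen.mem_nhds f.mem)] with x hx hxU
    exact (h.contDiffAt hxU).comp x hx
  regular := by
    rw [fderiv_comp 0 ((h.contDiffAt f.mem).differentiableAt (by simp))
      (f.smooth.self_of_nhds.differentiableAt (by simp))]
    exact (h.regular _ f.mem).comp f.regular
  mem := EtaleMap.extendZero_mem _ f.mem

lemma iteratedFDeriv_germ_comp (h : EtaleMap U V) (f : RegularGerm U) (k : ℕ) :
    iteratedFDeriv ℝ k (f.comp h).toFun 0 =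
      (ftaylorSeries ℝ (extendZero h.toFun) (f.toFun 0)).taylorComp
        (ftaylorSeries ℝ f.toFun 0) k :=
  iteratedFDeriv_comp (n := ∞) (h.contDiffAt f.mem) f.smooth.self_of_nhds
    (by exact_mod_cast le_top)

/-- The extension `S(h) : S(U) → S(V)` of an étale map `h : U → V`: the jet of `f` is mapped to
the jet of `h ∘ f`. -/
def map (h : EtaleMap U V) : Jet U → Jet V :=
  Quotient.map (RegularGerm.comp h) fun f g hfg k => by
    rw [iteratedFDeriv_germ_comp, iteratedFDeriv_germ_comp]
    have h0 : f.toFun 0 = g.toFun 0 := by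
      simpa using congrArg (fun a => a (fun _ => 0)) (hfg 0)
    have h1 : ftaylorSeries ℝ f.toFun 0 = ftaylorSeries ℝ g.toFun 0 := funext hfg
    rw [h0, h1]

lemma coeff_map (h : EtaleMap U V) (x : Jet U) (k : ℕ) :
    (map h x).coeff k = (ftaylorSeries ℝ (extendZero h.toFun) x.base).taylorComp
      (fun i => x.coeff i) k := by
  induction x using Quotient.inductionOn
  exact iteratedFDeriv_germ_comp h _ k

lemma base_map (h : EtaleMap U V) (x : Jet U) : (map h x).base = h.toFun x.base := by
  induction x using Quotient.inductionOn with | h f => ?_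
  exact Subtype.ext (extendZero_apply h.toFun ⟨f.toFun 0, f.mem⟩)

lemma coeff_map_congr (h : EtaleMap U V) {x y : Jet U} {k : ℕ}
    (hxy : ∀ j ≤ k, x.coeff j = y.coeff j) : ∀ j ≤ k, (map h x).coeff j = (map h y).coeff j := by
  intro j hj
  have h0 : (x.base : E n) = y.base := by
    rw [← coeff_zero_apply x 0, ← coeff_zero_apply y 0, hxy 0 (Nat.zero_le _)]
  rw [coeff_map, coeff_map, h0]
  refine Finset.sum_congr rfl fun c _ => ?_
  simp only [FormalMultilinearSeries.compAlongOrderedFinpartition]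
  congr 1
  funext i
  exact hxy _ ((c.partSize_le i).trans hj)

lemma contDiffAt_iteratedFDeriv (h : EtaleMap U V) {y : E n} (hy : y ∈ U) (j : ℕ) :
    ContDiffAt ℝ ∞ (iteratedFDeriv ℝ j (extendZero h.toFun)) y :=
  (h.contDiffAt hy).iteratedFDeriv_right (m := ∞) (by exact_mod_cast le_top)

lemma continuous_map (h : EtaleMap U V) : Continuous (map h) := by
  refine continuous_iInf_rng.2 fun k => continuous_induced_rng.2 ?_
  have : coeff k ∘ map h = fun x : Jet U => ∑ c : OrderedFinpartition k,
      c.compAlongOrderedFinpartitionL ℝ (E n) (E n) (E n)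
        (iteratedFDeriv ℝ c.length (extendZero h.toFun) x.base)
        (fun i => x.coeff (c.partSize i)) := funext fun x => coeff_map h x k
  rw [this]
  refine continuous_finsetSum _ fun c _ => ?_
  have h1 : Continuous fun x : Jet U =>
      iteratedFDeriv ℝ c.length (extendZero h.toFun) x.base :=
    continuous_iff_continuousAt.2 fun x =>
      (contDiffAt_iteratedFDeriv h x.base.2 _).continuousAt.comp
        (f := fun x : Jet U => (x.base : E n))
        (continuous_subtype_val.comp continuous_base).continuousAt
  have h2 : Continuous fun (x : Jet U) (i : Fin c.length) => x.coeff (c.partSize i) :=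
    continuous_pi fun i => continuous_coeff _
  exact ((c.compAlongOrderedFinpartitionL ℝ (E n) (E n) (E n)).flipMultilinear.cont.comp
    h2).clm_apply h1

lemma contDiffOn_map (h : EtaleMap U V) {m : ℕ} {N : Set (E m)} {p : E m → Jet U}
    (hp : ∀ k, ContDiffOn ℝ ∞ (fun t => (p t).coeff k) N) (k : ℕ) :
    ContDiffOn ℝ ∞ (fun t => (map h (p t)).coeff k) N := by
  have : (fun t => (map h (p t)).coeff k) = fun t => ∑ c : OrderedFinpartition k,
      c.compAlongOrderedFinpartitionL ℝ (E n) (E n) (E n)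
        (iteratedFDeriv ℝ c.length (extendZero h.toFun) (p t).base)
        (fun i => (p t).coeff (c.partSize i)) := funext fun t => coeff_map h (p t) k
  rw [this]
  refine ContDiffOn.sum fun c _ => ?_
  have h0 : ContDiffOn ℝ ∞ (fun t => ((p t).base : E n)) N := by
    simp_rw [← fun t => coeff_zero_apply (p t) 0]
    exact (ContinuousMultilinearMap.apply ℝ (fun _ : Fin 0 => E n) (E n) 0).contDiff.comp_contDiffOn
      (hp 0)
  have h1 : ContDiffOn ℝ ∞ (fun t =>
      iteratedFDeriv ℝ c.length (extendZero h.toFun) (p t).base) N := fun t ht =>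
    (contDiffAt_iteratedFDeriv h (p t).base.2 _).comp_contDiffWithinAt
      (f := fun t => ((p t).base : E n)) t (h0 t ht)
  have h2 : ContDiffOn ℝ ∞ (fun t (i : Fin c.length) => (p t).coeff (c.partSize i)) N :=
    contDiffOn_pi.2 fun i => hp _
  exact ((c.compAlongOrderedFinpartitionL ℝ (E n) (E n)
    (E n)).flipMultilinear.contDiff.comp_contDiffOn h2).clm_apply h1

lemma map_id (x : Jet U) : map (EtaleMap.incl le_rfl) x = x := by
  induction x using Quotient.inductionOn with | h f => ?_
  refine Quotient.sound fun k => ?_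
  have hc : ContinuousAt f.toFun 0 := f.smooth.self_of_nhds.continuousAt
  refine Filter.EventuallyEq.eq_of_nhds (Filter.EventuallyEq.iteratedFDeriv ℝ ?_ k)
  filter_upwards [hc.eventually (U.isOpen.mem_nhds f.mem)] with x hx
  exact extendZero_apply _ ⟨f.toFun x, hx⟩

lemma map_comp (h : EtaleMap U V) (g : EtaleMap V W) (x : Jet U) :
    map (h.comp g) x = map g (map h x) := by
  induction x using Quotient.inductionOn with | h f => ?_
  refine Quotient.sound fun k => ?_
  have hc : ContinuousAt f.toFun 0 := f.smooth.self_of_nhds.continuousAt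
  refine Filter.EventuallyEq.eq_of_nhds (Filter.EventuallyEq.iteratedFDeriv ℝ ?_ k)
  filter_upwards [hc.eventually (U.isOpen.mem_nhds f.mem)] with x hx
  exact EtaleMap.extendZero_comp _ _ hx

/-- The right action of `A ∈ GL(n, ℝ)` on jets: the jet of `f` is mapped to the jet of `f ∘ A`. -/
def act (A : E n ≃L[ℝ] E n) : Jet U → Jet U :=
  Quotient.map (fun f =>
    { toFun := f.toFun ∘ A
      smooth := by
        have hA : Filter.Tendsto A (𝓝 0) (𝓝 0) := by simpa using A.continuous.tendsto 0
        filter_upwards [hA.eventually f.smooth] with x hx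
        exact hx.comp x A.contDiff.contDiffAt
      regular := by
        rw [A.comp_right_fderiv, map_zero]
        exact f.regular.comp ⟨A, rfl⟩
      mem := by simpa using f.mem }) fun f g hfg k => by
    have key : ∀ u : RegularGerm U, iteratedFDeriv ℝ k (u.toFun ∘ A) 0 =
        (iteratedFDeriv ℝ k u.toFun 0).compContinuousLinearMap fun _ => (A : E n →L[ℝ] E n) := by
      intro u
      have := A.iteratedFDerivWithin_comp_right u.toFun uniqueDiffOn_univ (x := 0)
        (Set.mem_univ _) k
      simpa [iteratedFDerivWithin_univ] using this
    exact (key f).trans ((congrArg (fun M : E n [×k]→L[ℝ] E n =>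
      M.compContinuousLinearMap fun _ => (A : E n →L[ℝ] E n)) (hfg k)).trans (key g).symm)

lemma act_act (A B : E n ≃L[ℝ] E n) (x : Jet U) : act B (act A x) = act (B.trans A) x := by
  induction x using Quotient.inductionOn
  rfl

lemma act_refl (x : Jet U) : act (ContinuousLinearEquiv.refl ℝ (E n)) x = x := by
  induction x using Quotient.inductionOn
  rfl

lemma map_act (h : EtaleMap U V) (A : E n ≃L[ℝ] E n) (x : Jet U) :
    map h (act A x) = act A (map h x) := by
  induction x using Quotient.inductionOn
  rfl

lemma base_act (A : E n ≃L[ℝ] E n) (x : Jet U) : (act A x).base = x.base := by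
  induction x using Quotient.inductionOn with | h f => ?_
  exact Subtype.ext (congrArg f.toFun (map_zero A))

end Jet

/-- The four frame functors `S`, `S' = S/GL(n,ℝ)`, `S'' = S/O(n)` and `P`. -/
inductive FrameType where
  | S
  | SmodGL
  | SmodO
  | P

/-- The relation on infinite-order frames whose quotient is `Q(U)`: for `S` it is equality, for
`S'` and `S''` it is the orbit relation of `GL(n,ℝ)` and `O(n)`; `P(U)` is the space of linear
frames, i.e. of first-order jets of regular maps. -/
def FrameType.Rel (Q : FrameType) {n : ℕ} {U : Opens (E n)} (x y : Jet U) : Prop :=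
  match Q with
  | .S => x = y
  | .SmodGL => ∃ A : E n ≃L[ℝ] E n, x.act A = y
  | .SmodO => ∃ A : E n ≃ₗᵢ[ℝ] E n, x.act A.toContinuousLinearEquiv = y
  | .P => x.coeff 0 = y.coeff 0 ∧ x.coeff 1 = y.coeff 1

namespace FrameType

variable (Q : FrameType) {n : ℕ}

lemma rel_equivalence (U : Opens (E n)) : Equivalence (Q.Rel (U := U)) := by
  cases Q
  · exact ⟨fun _ => rfl, fun h => Eq.symm h, fun h h' => Eq.trans h h'⟩
  · refine ⟨fun x => ⟨_, x.act_refl⟩, ?_, ?_⟩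
    · rintro x _ ⟨A, rfl⟩
      refine ⟨A.symm, ?_⟩
      rw [Jet.act_act, A.symm_trans_self, Jet.act_refl]
    · rintro x _ _ ⟨A, rfl⟩ ⟨B, rfl⟩
      exact ⟨_, (Jet.act_act A B x).symm⟩
  · refine ⟨fun x => ⟨LinearIsometryEquiv.refl ℝ (E n), x.act_refl⟩, ?_, ?_⟩
    · rintro x _ ⟨A, rfl⟩
      refine ⟨A.symm, ?_⟩
      rw [Jet.act_act]
      exact (congrArg (fun B => x.act B) A.toContinuousLinearEquiv.symm_trans_self).trans x.act_refl
    · rintro x _ _ ⟨A, rfl⟩ ⟨B, rfl⟩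
      exact ⟨B.trans A, (Jet.act_act A.toContinuousLinearEquiv B.toContinuousLinearEquiv x).symm⟩
  · exact ⟨fun _ => ⟨rfl, rfl⟩, fun h => ⟨h.1.symm, h.2.symm⟩,
      fun h h' => ⟨h.1.trans h'.1, h.2.trans h'.2⟩⟩

lemma rel_map {U V : Opens (E n)} (h : EtaleMap U V) {x y : Jet U} (hxy : Q.Rel x y) :
    Q.Rel (x.map h) (y.map h) := by
  cases Q
  · exact congrArg _ hxy
  · obtain ⟨A, rfl⟩ := hxy
    exact ⟨A, (Jet.map_act h A x).symm⟩
  · obtain ⟨A, rfl⟩ := hxy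
    exact ⟨A, (Jet.map_act h _ x).symm⟩
  · have := Jet.coeff_map_congr h (x := x) (y := y) (k := 1) fun j hj => by
      interval_cases j
      · exact hxy.1
      · exact hxy.2
    exact ⟨this 0 (by simp), this 1 le_rfl⟩

lemma base_eq_of_rel {U : Opens (E n)} {x y : Jet U} (hxy : Q.Rel x y) : x.base = y.base := by
  cases Q
  · exact congrArg _ hxy
  · obtain ⟨A, rfl⟩ := hxy
    exact (Jet.base_act A x).symm
  · obtain ⟨A, rfl⟩ := hxy
    exact (Jet.base_act _ x).symm
  · refine Subtype.ext ?_
    rw [← Jet.coeff_zero_apply x 0, ← Jet.coeff_zero_apply y 0, hxy.1]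

/-- The set `Q(U)`. -/
def Frames (U : Opens (E n)) : Type := Quotient (⟨Q.Rel, Q.rel_equivalence U⟩ : Setoid (Jet U))

/-- The class in `Q(U)` of a frame of infinite order. -/
def mk {U : Opens (E n)} (x : Jet U) : Q.Frames U := Quotient.mk _ x

/-- The projection `Q(U) → U`. -/
def proj {U : Opens (E n)} : Q.Frames U → U :=
  Quotient.lift Jet.base fun _ _ h => Q.base_eq_of_rel h

/-- `Q(U)` carries the quotient topology. -/
instance (U : Opens (E n)) : TopologicalSpace (Q.Frames U) := .coinduced Q.mk inferInstance

/-- The space `Q(U)`. Its plots are the maps that locally lift to families of jets of infinite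
order, all of whose derivatives depend smoothly on the parameter; its `k`-th finite-dimensional
stage is the corresponding quotient of the space of jets of order `k`. -/
def space (U : Opens (E n)) : PlotSpace where
  carrier := Q.Frames U
  top := inferInstance
  IsPlot m p := ∀ t : E m, ∃ N : Set (E m), IsOpen N ∧ t ∈ N ∧ ∃ a : E m → Jet U,
    (∀ k, ContDiffOn ℝ ∞ (fun s => (a s).coeff k) N) ∧ ∀ s ∈ N, Q.mk (a s) = p s
  isPlot_comp {m m' p φ} hp hφ t := by
    obtain ⟨N, hN, ht, a, ha, hap⟩ := hp (φ t)
    exact ⟨φ ⁻¹' N, hN.preimage hφ.continuous, ht, a ∘ φ,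
      fun k => (ha k).comp hφ.contDiffOn fun _ h => h, fun s hs => hap _ hs⟩
  Agree k x y := ∃ a b : Jet U, Q.mk a = x ∧ Q.mk b = y ∧ ∀ j ≤ k, a.coeff j = b.coeff j
  agree_mono := by
    rintro k k' x y hk ⟨a, b, ha, hb, h⟩
    exact ⟨a, b, ha, hb, fun j hj => h j (hj.trans hk)⟩

/-- The extension `Q(h) : Q(U) → Q(V)` of an étale map `h : U → V`. -/
def map {U V : Opens (E n)} (h : EtaleMap U V) : Q.Frames U → Q.Frames V :=
  Quotient.map (Jet.map h) fun _ _ hxy => Q.rel_map h hxy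

lemma proj_map {U V : Opens (E n)} (h : EtaleMap U V) (x : Q.Frames U) :
    Q.proj (Q.map h x) = h.toFun (Q.proj x) := by
  induction x using Quotient.inductionOn
  exact Jet.base_map h _

/-- The functor `Q` from the category `𝒟ₙ`. -/
def functor (n : ℕ) : Dn n ⥤ PlotSpace where
  obj U := Q.space U.carrier
  map {U V} h :=
    { toFun := Q.map h
      continuous := continuous_coinduced_dom.2
        ((continuous_coinduced_rng (f := Q.mk)).comp (Jet.continuous_map h))
      isPlot := fun {m p} hp t => by
        obtain ⟨N, hN, ht, a, ha, hap⟩ := hp t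
        exact ⟨N, hN, ht, fun s => (a s).map h, Jet.contDiffOn_map h ha,
          fun s hs => congrArg (Q.map h) (hap s hs)⟩
      agree := by
        rintro k x y ⟨a, b, rfl, rfl, hab⟩
        exact ⟨a.map h, b.map h, rfl, rfl, Jet.coeff_map_congr h hab⟩ }
  map_id U := PlotSpace.Map.ext <| funext fun x => by
    induction x using Quotient.inductionOn
    exact congrArg Q.mk (Jet.map_id _)
  map_comp f g := PlotSpace.Map.ext <| funext fun x => by
    induction x using Quotient.inductionOn
    exact congrArg Q.mk (Jet.map_comp f g _)

end FrameType

/-! ### `𝒟ₙ`-spaces, atlases and covers -/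

/-- A `𝒟ₙ`-chart on a set `X`: an arbitrary map `k : U → X` on an open subset `U` of `ℝⁿ`. -/
structure Chart (n : ℕ) (X : Type u) where
  dom : Opens (E n)
  toFun : dom → X

/-- A morphism of charts: an étale map `m : U₁ → U₂` with `k₂ ∘ m = k₁`. -/
def Chart.IsMorphism {n : ℕ} {X : Type u} (c d : Chart n X) (m : EtaleMap c.dom d.dom) : Prop :=
  ∀ x, d.toFun (m.toFun x) = c.toFun x

/-- The chart `f ∘ k` on `Y`, for a chart `k` on `X` and a map `f : X → Y`. -/
def Chart.push {n : ℕ} {X Y : Type u} (f : X → Y) (c : Chart n X) : Chart n Y where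
  dom := c.dom
  toFun := f ∘ c.toFun

/-- A `𝒟ₙ`-atlas on `X`: a set `Φ` of charts and a category `C_Φ` with objects `Φ` whose arrows are
(some) morphisms of charts, such that `X` is the colimit in the category of sets of the domains of
the charts, i.e. the charts cover `X` and two points of the disjoint union of the domains have the
same image in `X` only if they are identified by the equivalence relation generated by the arrows
of `C_Φ`. -/
structure Atlas (n : ℕ) (X : Type u) where
  charts : Set (Chart n X)
  Mor : ∀ c d : charts, Set (EtaleMap c.1.dom d.1.dom)
  isMorphism : ∀ {c d : charts} {m}, m ∈ Mor c d → c.1.IsMorphism d.1 m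
  id_mem : ∀ c : charts, EtaleMap.incl le_rfl ∈ Mor c c
  comp_mem : ∀ {c d e : charts} {m m'}, m ∈ Mor c d → m' ∈ Mor d e → m.comp m' ∈ Mor c e
  covers : ∀ x : X, ∃ (c : charts) (u : c.1.dom), c.1.toFun u = x
  glue : ∀ (c d : charts) (u : c.1.dom) (v : d.1.dom), c.1.toFun u = d.1.toFun v →
    Relation.EqvGen (fun a b : Σ c : charts, c.1.dom => ∃ m ∈ Mor a.1 b.1, m.toFun a.2 = b.2)
      ⟨c, u⟩ ⟨d, v⟩

namespace Atlas

variable {n : ℕ} {X : Type u}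

/-- The maximal atlas generated by an atlas: it consists of all charts that locally factor through
the charts of the atlas by étale maps. -/
def maximal (A : Atlas n X) : Set (Chart n X) :=
  {V | ∀ v : V.dom, ∃ (W : Opens (E n)) (hW : W ≤ V.dom), (v : E n) ∈ W ∧
    ∃ (c : A.charts) (m : EtaleMap W c.1.dom), ∀ w : W, c.1.toFun (m.toFun w) = V.toFun ⟨w, hW w.2⟩}

/-- An atlas `Φ` is full if for each chart `V` of the maximal atlas and each `y ∈ V` there are a
chart `U ∈ Φ` and a morphism of charts `m : U → V` with `y ∈ m(U)`. -/
def IsFull (A : Atlas n X) : Prop :=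
  ∀ V ∈ A.maximal, ∀ y : V.dom, ∃ (c : A.charts) (m : EtaleMap c.1.dom V.dom),
    c.1.IsMorphism V m ∧ ∃ u, m.toFun u = y

/-- A cover `𝒰` defined by an atlas: a base of the topology of the disjoint union of the domains of
the charts, consisting of open subsets `U` of the domains of the charts. -/
structure Cover (A : Atlas n X) where
  sets : A.charts → Set (Opens (E n))
  le_dom : ∀ {c : A.charts} {U : Opens (E n)}, U ∈ sets c → U ≤ c.1.dom
  basis : ∀ (c : A.charts) (O : Opens (E n)), O ≤ c.1.dom → ∀ x ∈ O, ∃ U ∈ sets c, x ∈ U ∧ U ≤ O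

end Atlas

namespace Atlas.Cover

variable {n : ℕ} {X : Type u} {A : Atlas n X}

/-- The elements of the cover `𝒰`. -/
structure Obj (𝒰 : A.Cover) where
  chart : A.charts
  set : Opens (E n)
  mem : set ∈ 𝒰.sets chart

/-- The category of the elements of the cover `𝒰`; an arrow `U → V` is an étale map which is the
restriction of an arrow of `C_Φ` between the charts containing `U` and `V`. -/
instance (𝒰 : A.Cover) : Category.{0} 𝒰.Obj where
  Hom U V := {h : EtaleMap U.set V.set // ∃ m ∈ A.Mor U.chart V.chart,
    ∀ x : U.set, (h.toFun x : E n) = m.toFun ⟨x, 𝒰.le_dom U.mem x.2⟩}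
  id U := ⟨EtaleMap.incl le_rfl, EtaleMap.incl le_rfl, A.id_mem U.chart, fun _ => rfl⟩
  comp f g := ⟨f.1.comp g.1, by
    obtain ⟨m, hm, hfm⟩ := f.2
    obtain ⟨m', hm', hgm⟩ := g.2
    refine ⟨m.comp m', A.comp_mem hm hm', fun x => (hgm _).trans ?_⟩
    exact congrArg (fun y => (m'.toFun y : E n)) (Subtype.ext (hfm x))⟩

/-- The functor from the category of the elements of the cover to `𝒟ₙ`. -/
def toDn (𝒰 : A.Cover) : 𝒰.Obj ⥤ Dn n where
  obj U := ⟨U.set⟩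
  map h := h.1

/-- The cover `𝒰_Q` of `Q(X)`: its elements are the `Q(U)` for `U ∈ 𝒰`, and its arrows are the
extensions `Q(h) : Q(U) → Q(V)` of the arrows `h : U → V` of `𝒰`. -/
def frameCover (𝒰 : A.Cover) (Q : FrameType) : 𝒰.Obj ⥤ PlotSpace :=
  𝒰.toDn ⋙ Q.functor n

/-- A complete cover `𝒰̄_Q` of `Q(X)` made from `𝒰`: a base of the topologies of the `Q(U)`,
`U ∈ 𝒰`, which contains every `Q(U)`. The elements are open subsets `V` of `Q(U)` for the `U ∈ 𝒰`
onto which they project, `p(V) = U`. -/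
structure CompleteFrameCover (𝒰 : A.Cover) (Q : FrameType) where
  sets : ∀ U : 𝒰.Obj, Set (Opens (Q.Frames U.set))
  proj_eq : ∀ {U : 𝒰.Obj} {V : Opens (Q.Frames U.set)}, V ∈ sets U → Q.proj '' (V : Set (Q.Frames U.set)) = Set.univ
  top_mem : ∀ U : 𝒰.Obj, ⊤ ∈ sets U
  basis : ∀ (U : 𝒰.Obj) (O : Opens (Q.Frames U.set)), ∀ x ∈ O,
    ∃ (U' : 𝒰.Obj) (hU : U'.set ≤ U.set), U'.chart = U.chart ∧ ∃ V ∈ sets U',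
      (∃ y ∈ V, Q.map (EtaleMap.incl hU) y = x) ∧ ∀ y ∈ V, Q.map (EtaleMap.incl hU) y ∈ O

namespace CompleteFrameCover

variable {𝒰 : A.Cover} {Q : FrameType}

/-- The elements of the complete cover: open subsets `V ⊆ Q(U)`. -/
structure Obj (B : 𝒰.CompleteFrameCover Q) where
  base : 𝒰.Obj
  set : Opens (Q.Frames base.set)
  mem : set ∈ B.sets base

/-- The open subset `V` of `Q(U)` as a space. -/
def Obj.space {B : 𝒰.CompleteFrameCover Q} (V : B.Obj) : PlotSpace :=
  (Q.space V.base.set).restrict V.set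

/-- The inclusion of `V` into `Q(U)`. -/
def Obj.toFrames {B : 𝒰.CompleteFrameCover Q} (V : B.Obj) (x : V.space.carrier) :
    Q.Frames V.base.set :=
  Subtype.val (p := fun y => y ∈ V.set) x

/-- The arrows `V → V'` of the complete cover, for open subsets `V ⊆ Q(U)` and `V' ⊆ Q(U')`: the
maps `g : V → V'` which are restrictions of the extensions `Q(h) : Q(U) → Q(U')` of the arrows
`h : U → U'` of `𝒰`. -/
instance (B : 𝒰.CompleteFrameCover Q) : Category.{0} B.Obj where
  Hom V V' := {g : V.space ⟶ V'.space // ∃ h : V.base ⟶ V'.base,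
    ∀ x : V.space.carrier, V'.toFrames (g.toFun x) = Q.map h.1 (V.toFrames x)}
  id V := ⟨𝟙 _, 𝟙 _, fun x => (congrFun (congrArg PlotSpace.Map.toFun
    ((Q.functor n).map_id ⟨V.base.set⟩)) x.1).symm⟩
  comp f g := ⟨f.1 ≫ g.1, by
    obtain ⟨h, hf⟩ := f.2
    obtain ⟨h', hg⟩ := g.2
    refine ⟨h ≫ h', fun x => (hg _).trans ?_⟩
    refine (congrArg (Q.map h'.1) (hf x)).trans ?_
    exact (congrFun (congrArg PlotSpace.Map.toFun ((𝒰.toDn ⋙ Q.functor n).map_comp h h')) x.1).symm⟩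

/-- The cover `𝒰̄_Q` as a diagram of spaces. -/
def diagram (B : 𝒰.CompleteFrameCover Q) : B.Obj ⥤ PlotSpace where
  obj V := V.space
  map g := g.1

/-- The inclusion of the cover `𝒰_Q` into the cover `𝒰̄_Q`. -/
def inclusion (B : 𝒰.CompleteFrameCover Q) : 𝒰.Obj ⥤ B.Obj where
  obj U := ⟨U, ⊤, B.top_mem U⟩
  map h := ⟨PlotSpace.restrictMap ((𝒰.frameCover Q).map h) _ _ fun _ _ => trivial,
    h, fun _ => rfl⟩
  map_id U := Subtype.ext <| PlotSpace.Map.ext <| funext fun x => Subtype.ext <|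
    congrFun (congrArg PlotSpace.Map.toFun ((𝒰.frameCover Q).map_id U)) x.1
  map_comp f g := Subtype.ext <| PlotSpace.Map.ext <| funext fun x => Subtype.ext <|
    congrFun (congrArg PlotSpace.Map.toFun ((𝒰.frameCover Q).map_comp f g)) x.1

/-- As `p(V) = U`, an arrow `g : V → V'` is the restriction of `Q(h)` for a unique `h`. -/
lemma base_unique (B : 𝒰.CompleteFrameCover Q) {V V' : B.Obj} {h h' : V.base ⟶ V'.base}
    (H : ∀ x : V.space.carrier, Q.map h.1 (V.toFrames x) = Q.map h'.1 (V.toFrames x)) : h = h' := by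
  refine Subtype.ext (EtaleMap.ext (funext fun u => ?_))
  obtain ⟨x, hx, rfl⟩ := (B.proj_eq V.mem).symm ▸ Set.mem_univ u
  rw [← Q.proj_map, ← Q.proj_map]
  exact congrArg Q.proj (H ⟨x, hx⟩)

/-- The arrow `h : U → U'` of `𝒰` which underlies an arrow `g : V → V'`. -/
def baseArrow (B : 𝒰.CompleteFrameCover Q) {V V' : B.Obj} (g : V ⟶ V') : V.base ⟶ V'.base :=
  g.2.choose

lemma map_baseArrow (B : 𝒰.CompleteFrameCover Q) {V V' : B.Obj} (g : V ⟶ V') (x : V.space.carrier) :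
    V'.toFrames (g.1.toFun x) = Q.map (B.baseArrow g).1 (V.toFrames x) :=
  g.2.choose_spec x

lemma baseArrow_eq (B : 𝒰.CompleteFrameCover Q) {V V' : B.Obj} (g : V ⟶ V') (h : V.base ⟶ V'.base)
    (H : ∀ x : V.space.carrier, V'.toFrames (g.1.toFun x) = Q.map h.1 (V.toFrames x)) :
    B.baseArrow g = h :=
  B.base_unique fun x => (B.map_baseArrow g x).symm.trans (H x)

/-- The functor from the cover `𝒰̄_Q` to the cover `𝒰`, which maps `V ⊆ Q(U)` to `U = p(V)`, and
`g = Q(h)|_V` to `h`. -/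
def baseFunctor (B : 𝒰.CompleteFrameCover Q) : B.Obj ⥤ 𝒰.Obj where
  obj V := V.base
  map g := B.baseArrow g
  map_id V := B.baseArrow_eq _ _ fun x => (congrFun (congrArg PlotSpace.Map.toFun
    ((Q.functor n).map_id ⟨V.base.set⟩)) x.1).symm
  map_comp {V V' V''} f g := B.baseArrow_eq _ _ fun x => by
    refine (B.map_baseArrow g _).trans ?_
    refine (congrArg (Q.map (B.baseArrow g).1) (B.map_baseArrow f x)).trans ?_
    exact (congrFun (congrArg PlotSpace.Map.toFun ((𝒰.toDn ⋙ Q.functor n).map_comp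
      (B.baseArrow f) (B.baseArrow g))) x.1).symm

/-- The restriction `λ` of cochains for `𝒰̄_Q` to the strings of morphisms of `𝒰_Q`,
`λ(c)(Q(h₁), …, Q(h_k)) = c(Q(h₁), …, Q(h_k))`. -/
def restriction (B : 𝒰.CompleteFrameCover Q) :
    cechDeRham B.diagram ⟶ cechDeRham (𝒰.frameCover Q) :=
  cechDeRhamMap B.inclusion
    { app := fun U => PlotSpace.toRestrictTop (Q.space U.set) ⊤ rfl
      naturality := fun _ _ _ => rfl }

/-- The extension `μ` of cochains from `𝒰_Q` to `𝒰̄_Q`,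
`μ(φ)(g₁, …, g_k) = φ(Q(h₁), …, Q(h_k))|_{V₀}` for `gᵢ` the restriction of `Q(hᵢ)`. -/
def extension (B : 𝒰.CompleteFrameCover Q) :
    cechDeRham (𝒰.frameCover Q) ⟶ cechDeRham B.diagram :=
  cechDeRhamMap B.baseFunctor
    { app := fun V => (Q.space V.base.set).inclusion V.set
      naturality := fun _ _ g => PlotSpace.Map.ext <| funext fun x => B.map_baseArrow g x }

end CompleteFrameCover

/-! ### Functoriality in `X` -/

variable {Y : Type u} {A' : Atlas n Y}

/-- A map `f : X → Y` is compatible with covers `𝒰` of `X` and `𝒰'` of `Y` if `(U, k) ↦ (U, f ∘ k)`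
maps the charts, the arrows of charts, and the elements of the cover of `X` to those of `Y`. -/
structure IsCompatible (f : X → Y) (𝒰 : A.Cover) (𝒰' : A'.Cover) : Prop where
  chart : ∀ c : A.charts, c.1.push f ∈ A'.charts
  mor : ∀ (c d : A.charts) (m : EtaleMap c.1.dom d.1.dom), m ∈ A.Mor c d →
    m ∈ A'.Mor ⟨c.1.push f, chart c⟩ ⟨d.1.push f, chart d⟩
  sets : ∀ (c : A.charts) (U : Opens (E n)), U ∈ 𝒰.sets c → U ∈ 𝒰'.sets ⟨c.1.push f, chart c⟩

namespace IsCompatible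

variable {f : X → Y} {𝒰 : A.Cover} {𝒰' : A'.Cover} (hf : IsCompatible f 𝒰 𝒰') {Q : FrameType}

/-- The induced functor on the elements of the covers. -/
def functor : 𝒰.Obj ⥤ 𝒰'.Obj where
  obj U := ⟨⟨U.chart.1.push f, hf.chart U.chart⟩, U.set, hf.sets _ _ U.mem⟩
  map h := ⟨h.1, h.2.choose, hf.mor _ _ _ h.2.choose_spec.1, h.2.choose_spec.2⟩

/-- The map `f^*` of Čech–de Rham complexes for the covers `𝒰_Q` and `𝒰'_Q`. -/
def pullback (Q : FrameType) :
    cechDeRham (𝒰'.frameCover Q) ⟶ cechDeRham (𝒰.frameCover Q) :=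
  cechDeRhamMap hf.functor
    { app := fun U => 𝟙 (Q.space U.set)
      naturality := fun _ _ _ => rfl }

variable {B : 𝒰.CompleteFrameCover Q} {B' : 𝒰'.CompleteFrameCover Q}
  (hB : ∀ U : 𝒰.Obj, B.sets U ⊆ B'.sets (hf.functor.obj U))

/-- The induced functor on the elements of the complete covers. -/
def completeFunctor : B.Obj ⥤ B'.Obj where
  obj V := ⟨hf.functor.obj V.base, V.set, hB _ V.mem⟩
  map g := ⟨g.1, hf.functor.map (B.baseArrow g), B.map_baseArrow g⟩

/-- The map `f^*` of Čech–de Rham complexes for the complete covers. -/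
def completePullback : cechDeRham B'.diagram ⟶ cechDeRham B.diagram :=
  cechDeRhamMap (hf.completeFunctor hB)
    { app := fun V => 𝟙 V.space
      naturality := fun _ _ _ => rfl }

end IsCompatible

end Atlas.Cover

end CechDeRham

end

/-! The statement is about nerves of categories; no Poincaré lemma or partition of unity is needed.
Let `inclusion` send `U` to `Q(U)`, and let `baseFunctor` send `V ⊆ Q(U)` to `U`. The latter is a
functor because `p(V) = U`, so that `V` sees every point of `U` and an arrow of the complete cover
determines the étale map `h` below it. The cochain maps `λ` and `μ` are the pullbacks along these
two functors.

Going from `𝒰` to the complete cover and back is the identity functor, so `λ ∘ μ` is the identity of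
cochains (`extension_comp_restriction`). The other composite functor `G` replaces `V` by the whole
of `Q(U)`, and the inclusions `V ⊆ Q(U)` form a natural transformation `unit` from the identity to
`G`. As for nerves, such a transformation gives a homotopy between the identity and the pullback by
`G` (`cechDeRhamHomotopy`). It is the alternating sum over the top simplices of the prism `Δ¹ × Δᵖ`,
and its homotopy formula is the boundary formula of the prism (`sum_prism_zero`, `sum_prism_succ`).
Pullback commutes with `d`, so the prism operator passes to the total complex.

Naturality in `X` holds already for cochains: the base functors commute with the functors induced by
`f` (`completeFunctor_comp_baseFunctor`). -/

noncomputable section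

namespace CechDeRham

/-! ### The prism decomposition of `Δ¹ × Δᵖ` -/

section Prism

/-- The `i`-th top-dimensional simplex of the prism `Δ¹ × Δᵖ`, the chain
`(0, 0) < ⋯ < (0, i) < (1, i) < ⋯ < (1, p)`. -/
def prismSimplex {p : ℕ} (i : Fin (p + 1)) : Fin (p + 2) →o Fin 2 × Fin (p + 1) where
  toFun k := (if k ≤ i.castSucc then 0 else 1, i.predAbove k)
  monotone' k l hkl := by
    refine ⟨?_, Fin.predAbove_right_monotone i hkl⟩
    dsimp only
    split_ifs with h1 h2
    · exact le_rfl
    · exact Fin.zero_le _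
    · exact absurd (hkl.trans ‹_›) h1
    · exact le_rfl

/-- The chain `(0, 0) < ⋯ < (0, i - 1) < (1, i) < ⋯ < (1, p)` in `Δ¹ × Δᵖ`. -/
def prismWall {p : ℕ} (i : Fin (p + 2)) : Fin (p + 1) →o Fin 2 × Fin (p + 1) where
  toFun k := (if k.castSucc < i then 0 else 1, k)
  monotone' k l hkl := by
    refine ⟨?_, hkl⟩
    dsimp only
    split_ifs with h1 h2
    · exact le_rfl
    · exact Fin.zero_le _
    · exact absurd (lt_of_le_of_lt (Fin.castSucc_le_castSucc_iff.2 hkl) ‹_›) h1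
    · exact le_rfl

/-- The slice `{a} × Δᵖ` of `Δ¹ × Δᵖ`. -/
def prismSlice (p : ℕ) (a : Fin 2) : Fin (p + 1) →o Fin 2 × Fin (p + 1) where
  toFun k := (a, k)
  monotone' _ _ hkl := ⟨le_rfl, hkl⟩

lemma prismWall_zero (p : ℕ) : prismWall (0 : Fin (p + 2)) = prismSlice p 1 := by
  ext k : 2
  exact Prod.ext (if_neg (t := (0 : Fin 2)) (Fin.not_lt_zero k.castSucc)) rfl

lemma prismWall_last (p : ℕ) : prismWall (Fin.last (p + 1)) = prismSlice p 0 := by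
  ext k : 2
  exact Prod.ext (if_pos (Fin.castSucc_lt_last k)) rfl

/-- The face map `Δᵖ → Δ^{p+1}` which omits the vertex `i`. -/
abbrev coface {p : ℕ} (i : Fin (p + 2)) : Fin (p + 1) →o Fin (p + 2) :=
  (Fin.succAboveOrderEmb i).toOrderHom

lemma val_succAbove {p : ℕ} (i : Fin (p + 1)) (k : Fin p) :
    (i.succAbove k : ℕ) = if (k : ℕ) < i then (k : ℕ) else k + 1 := by
  simp only [Fin.succAbove, Fin.lt_def, Fin.val_castSucc]
  split_ifs <;> rfl

lemma val_predAbove {p : ℕ} (i : Fin p) (k : Fin (p + 1)) :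
    (i.predAbove k : ℕ) = if (i : ℕ) < k then (k : ℕ) - 1 else k := by
  simp only [Fin.predAbove, Fin.lt_def, Fin.val_castSucc]
  split_ifs <;> rfl

/-- The `i`-th simplex has two vertices over `i`, namely `(0, i)` and `(1, i)`. Omitting the first
leaves wall `i`, omitting the second leaves wall `i + 1`. Consecutive simplices thus share a wall,
and these inner walls will cancel. -/
lemma prismSimplex_comp_coface_castSucc {p : ℕ} (i : Fin (p + 1)) :
    (prismSimplex i).comp (coface i.castSucc) = prismWall i.castSucc := by
  ext k : 2
  refine Prod.ext (if_congr ?_ rfl rfl) (Fin.predAbove_succAbove i k)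
  change i.castSucc.succAbove k ≤ i.castSucc ↔ k.castSucc < i.castSucc
  simp only [Fin.le_def, Fin.lt_def, val_succAbove, Fin.val_castSucc]
  split_ifs <;> omega

lemma prismSimplex_comp_coface_succ {p : ℕ} (i : Fin (p + 1)) :
    (prismSimplex i).comp (coface i.succ) = prismWall i.succ := by
  ext k : 2
  refine Prod.ext (if_congr ?_ rfl rfl) (Fin.ext ?_)
  · change i.succ.succAbove k ≤ i.castSucc ↔ k.castSucc < i.succ
    simp only [Fin.le_def, Fin.lt_def, val_succAbove, Fin.val_castSucc, Fin.val_succ]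
    split_ifs <;> omega
  · change (i.predAbove (i.succ.succAbove k) : ℕ) = k
    simp only [val_predAbove, val_succAbove, Fin.val_succ]
    split_ifs <;> omega

/-- Omitting the only vertex over some `l ≠ i` leaves a top simplex of the smaller prism over the
`l`-th face of `Δ^{p+1}`. Here `l` is written as `i.succAbove j`; the column where the new simplex
jumps is `i - 1` for `l < i` and `i` for `l > i`, which is `j.predAbove i`. -/
lemma prismSimplex_comp_coface {p : ℕ} (i : Fin (p + 2)) (j : Fin (p + 1)) :
    (prismSimplex i).comp (coface (i.castSucc.succAbove (i.succAbove j))) =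
      (OrderHom.id.prodMap (coface (i.succAbove j))).comp (prismSimplex (j.predAbove i)) := by
  ext k : 2
  refine Prod.ext (if_congr ?_ rfl rfl) (Fin.ext ?_)
  · change (i.castSucc.succAbove (i.succAbove j)).succAbove k ≤ i.castSucc ↔
      k ≤ (j.predAbove i).castSucc
    simp only [Fin.le_def, val_succAbove, val_predAbove, Fin.val_castSucc]
    split_ifs <;> omega
  · change (i.predAbove ((i.castSucc.succAbove (i.succAbove j)).succAbove k) : ℕ) =
      (i.succAbove j).succAbove ((j.predAbove i).predAbove k)
    simp only [val_succAbove, val_predAbove, Fin.val_castSucc]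
    split_ifs <;> omega

/-- The omitted vertex has index `j` if `j < i` and `j + 2` otherwise, so its parity is always that
of `j`. -/
lemma neg_one_pow_succAbove_succAbove {p : ℕ} (i : Fin (p + 2)) (j : Fin (p + 1)) :
    (-1 : ℝ) ^ ((i : ℕ) + (i.castSucc.succAbove (i.succAbove j) : Fin (p + 3))) =
      (-1) ^ ((i : ℕ) + (j : ℕ)) := by
  rcases lt_or_ge (j : ℕ) i with h | h
  · simp [val_succAbove, h]
  · simp [val_succAbove, h.not_gt, (h.trans (Nat.le_succ _)).not_gt, pow_add]

lemma sum_sub_telescope {M : Type*} [AddCommGroup M] {p : ℕ} (g : Fin (p + 2) → M) :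
    ∑ i : Fin (p + 1), (g i.castSucc - g i.succ) = g 0 - g (Fin.last (p + 1)) := by
  rw [Finset.sum_sub_distrib, sub_eq_sub_iff_add_eq_add, ← Fin.sum_univ_castSucc,
    ← Fin.sum_univ_succ]

variable {M : Type*} [AddCommGroup M] [Module ℝ M]

/-- The boundary of one simplex, with its two walls (vertices `i` and `i + 1`, of opposite sign)
split off. After removal of vertex `i`, the entry `j = i` of the remaining sum stands for vertex `i
+ 1`; it is replaced by zero, so that one formula serves `p = 0` and `p > 0`. -/
lemma sum_coface_prismSimplex {p : ℕ} (f : (Fin (p + 1) →o Fin 2 × Fin (p + 1)) → M)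
    (i : Fin (p + 1)) :
    ∑ j : Fin (p + 2), (-1 : ℝ) ^ ((i : ℕ) + (j : ℕ)) • f ((prismSimplex i).comp (coface j)) =
      f (prismWall i.castSucc) - f (prismWall i.succ) + ∑ j : Fin (p + 1), if j = i then 0 else
        (-1 : ℝ) ^ ((i : ℕ) + (i.castSucc.succAbove j : Fin (p + 2))) •
          f ((prismSimplex i).comp (coface (i.castSucc.succAbove j))) := by
  rw [Fin.sum_univ_succAbove _ i.castSucc, prismSimplex_comp_coface_castSucc, sub_add,
    sub_eq_add_neg]
  congr 1
  · simp [← two_mul]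
  · rw [← Finset.add_sum_erase _ _ (Finset.mem_univ i), neg_sub, sub_eq_add_neg, add_comm]
    rw [← Finset.add_sum_erase Finset.univ (fun j => if j = i then (0 : M) else _)
      (Finset.mem_univ i), if_pos rfl, zero_add]
    congr 1
    · refine Finset.sum_congr rfl fun j hj => (if_neg (Finset.ne_of_mem_erase hj)).symm
    · rw [Fin.succAbove_castSucc_self, prismSimplex_comp_coface_succ]
      simp [pow_add, pow_succ, ← mul_pow]

lemma sum_prism_zero (f : (Fin 1 →o Fin 2 × Fin 1) → M) :
    ∑ i : Fin 1, ∑ j : Fin 2, (-1 : ℝ) ^ ((i : ℕ) + (j : ℕ)) •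
        f ((prismSimplex i).comp (coface j)) = f (prismSlice 0 1) - f (prismSlice 0 0) := by
  simp only [sum_coface_prismSimplex, Finset.univ_unique, Finset.sum_singleton, Subsingleton.elim _ (0 : Fin 1),
    if_true, Finset.sum_const_zero, add_zero]
  rw [← prismWall_zero, ← prismWall_last]
  rfl

/-- The boundary of the prism `Δ¹ × Δᵖ`, `p > 0`. -/
lemma sum_prism_succ {p : ℕ} (f : (Fin (p + 2) →o Fin 2 × Fin (p + 2)) → M) :
    ∑ i : Fin (p + 2), ∑ j : Fin (p + 3), (-1 : ℝ) ^ ((i : ℕ) + (j : ℕ)) •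
        f ((prismSimplex i).comp (coface j)) +
      ∑ i : Fin (p + 2), ∑ j : Fin (p + 1), (-1 : ℝ) ^ ((i : ℕ) + (j : ℕ)) •
        f ((OrderHom.id.prodMap (coface i)).comp (prismSimplex j)) =
      f (prismSlice (p + 1) 1) - f (prismSlice (p + 1) 0) := by
  simp only [sum_coface_prismSimplex, Finset.sum_add_distrib]
  -- The walls telescope to the two end slices; what is left to show is that the side faces cancel
  -- against the prisms over the faces.
  rw [sum_sub_telescope fun i => f (prismWall i), prismWall_zero, prismWall_last, add_assoc,
    add_eq_left]
  have h : ∀ i : Fin (p + 2), (∑ j : Fin (p + 2), if j = i then (0 : M) else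
        (-1 : ℝ) ^ ((i : ℕ) + (i.castSucc.succAbove j : Fin (p + 3))) •
          f ((prismSimplex i).comp (coface (i.castSucc.succAbove j)))) =
      ∑ j : Fin (p + 1), (-1 : ℝ) ^ ((i : ℕ) + (j : ℕ)) •
        f ((OrderHom.id.prodMap (coface (i.succAbove j))).comp
          (prismSimplex (j.predAbove i))) := fun i => by
    rw [Fin.sum_univ_succAbove _ i, if_pos rfl, zero_add]
    refine Finset.sum_congr rfl fun j _ => ?_
    rw [if_neg (Fin.succAbove_ne i j), neg_one_pow_succAbove_succAbove, prismSimplex_comp_coface]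
  simp only [h]
  rw [← Finset.sum_product', ← Finset.sum_product', Finset.univ_product_univ,
    ← eq_neg_iff_add_eq_zero, ← Finset.sum_neg_distrib]
  -- The involution from the proof of `δ² = 0` matches the two sums term by term, and it reverses
  -- the parity of `i + j`.
  refine Finset.sum_nbij' (fun x => (x.1.succAbove x.2, x.2.predAbove x.1))
    (fun x => (x.1.succAbove x.2, x.2.predAbove x.1)) (fun _ _ => Finset.mem_univ _)
    (fun _ _ => Finset.mem_univ _) ?_ ?_ ?_
  · exact fun x _ => Prod.ext (Fin.succAbove_succAbove_predAbove x.1 x.2)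
      (Fin.predAbove_predAbove_succAbove x.1 x.2)
  · exact fun x _ => Prod.ext (Fin.succAbove_succAbove_predAbove x.1 x.2)
      (Fin.predAbove_predAbove_succAbove x.1 x.2)
  · intro x _
    rw [Fin.neg_one_pow_succAbove_add_predAbove, neg_smul, neg_neg]

end Prism

/-! ### The homotopy defined by a natural transformation -/

section Homotopy

variable {C : Type u} [Category.{0} C]

/-- The functor `[1] × [p] ⥤ C` defined by a string and a natural transformation `𝟭 C ⟶ G`. -/
def prism {G : C ⥤ C} (η : 𝟭 C ⟶ G) {p : ℕ} (s : ComposableArrows C p) :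
    Fin 2 × Fin (p + 1) ⥤ C :=
  (𝟭 (Fin 2)).prod s ⋙ Functor.uncurry.obj (ComposableArrows.mk₁ η)

/-- The string in a prism over `s` cut out by a chain in `Δ¹ × Δᵖ`. -/
def prismString {G : C ⥤ C} (η : 𝟭 C ⟶ G) {p k : ℕ} (s : ComposableArrows C p)
    (θ : Fin (k + 1) →o Fin 2 × Fin (p + 1)) : ComposableArrows C k :=
  Functor.prod' (monotone_fst.comp θ.monotone).functor (monotone_snd.comp θ.monotone).functor ⋙
    prism η s

/-- The arrow from the first object of `s` to that of a string in the prism over `s`. -/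
def prismArrow {G : C ⥤ C} (η : 𝟭 C ⟶ G) {p k : ℕ} (s : ComposableArrows C p)
    (θ : Fin (k + 1) →o Fin 2 × Fin (p + 1)) : s.obj 0 ⟶ (prismString η s θ).obj 0 :=
  (prism η s).map (Prod.mkHom (X₁ := (0 : Fin 2)) (X₂ := (θ 0).1)
    (Y₁ := (0 : Fin (p + 1))) (Y₂ := (θ 0).2) (homOfLE (Fin.zero_le _)) (homOfLE (Fin.zero_le _)))

variable (F : C ⥤ PlotSpace)

/-- The value of a cochain on a string in the prism over `s`, pulled back to the first object
of `s`. -/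
def prismEval {G : C ⥤ C} (η : 𝟭 C ⟶ G) {p k : ℕ} (q : ℕ) (s : ComposableArrows C p)
    (θ : Fin (k + 1) →o Fin 2 × Fin (p + 1)) : Cochain F k q →ₗ[ℝ] Form q (F.obj (s.obj 0)) :=
  (Form.pullback (F.map (prismArrow η s θ))).comp (Cochain.eval F q (prismString η s θ))

/-- The prism operator `C^{p+1,q} → C^{p,q}`,
`α ↦ ∑ᵢ (-1)^i α(U₀ → ⋯ → Uᵢ → G(Uᵢ) → ⋯ → G(U_p))`. -/
def prismOperator {G : C ⥤ C} (η : 𝟭 C ⟶ G) (p q : ℕ) :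
    Cochain F (p + 1) q →ₗ[ℝ] Cochain F p q :=
  Cochain.lift F fun s => ∑ i : Fin (p + 1), (-1 : ℝ) ^ (i : ℕ) • prismEval F η q s (prismSimplex i)

variable {G : C ⥤ C} (η : 𝟭 C ⟶ G)

/-- The natural family of smooth maps `F(U) → F(G(U))` defined by `η`. -/
def spaceTrans : F ⟶ G ⋙ F where
  app V := F.map (η.app V)
  naturality V W f := by
    change F.map f ≫ F.map (η.app W) = F.map (η.app V) ≫ F.map (G.map f)
    rw [← F.map_comp, ← F.map_comp]
    exact congrArg F.map (η.naturality f)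

lemma prismOperator_apply {p q : ℕ} (α : Cochain F (p + 1) q) (s : ComposableArrows C p) :
    prismOperator F η p q α s =
      ∑ i : Fin (p + 1), (-1 : ℝ) ^ (i : ℕ) • prismEval F η q s (prismSimplex i) α := by
  simp only [prismOperator, Cochain.lift, LinearMap.coe_mk, LinearMap.sum_apply,
    LinearMap.smul_apply]
  rfl

lemma prismOperator_deRham {p q : ℕ} (α : Cochain F (p + 1) q) :
    prismOperator F η p (q + 1) (deRham F (p + 1) q α) =
      deRham F p q (prismOperator F η p q α) := by
  funext s
  change _ = Form.d (prismOperator F η p q α s)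
  simp only [prismOperator_apply, map_sum, map_smul]
  rfl

/-- A face of the string along `θ` is the string along `θ.comp (coface j)`, and functoriality of the
prism merges the two pullbacks into one. This turns `δ` into a sum over chains in `Δ¹ × Δᵖ`. -/
lemma prismEval_delta {p k q : ℕ} (s : ComposableArrows C p)
    (θ : Fin (k + 2) →o Fin 2 × Fin (p + 1)) (α : Cochain F k q) :
    prismEval F η q s θ (delta F k q α) =
      ∑ j : Fin (k + 2), (-1 : ℝ) ^ (j : ℕ) • prismEval F η q s (θ.comp (coface j)) α := by
  change Form.pullback (F.map (prismArrow η s θ)) (delta F k q α (prismString η s θ)) = _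
  simp only [delta_apply, map_sum, map_smul, ← Form.pullback_comp, ← Functor.map_comp]
  refine Finset.sum_congr rfl fun j _ => ?_
  have : prismArrow η s θ ≫ faceArrow j (prismString η s θ) =
      prismArrow η s (θ.comp (coface j)) := ((prism η s).map_comp _ _).symm
  rw [this]
  rfl

/-- The prism over a face of `s` is the restriction of the prism over `s`, so the terms of `δ` after
the prism operator are also values on chains in the large prism. -/
lemma pullback_prismEval_face {p k q : ℕ} (s : ComposableArrows C (p + 1)) (i : Fin (p + 2))
    (θ : Fin (k + 1) →o Fin 2 × Fin (p + 1)) (α : Cochain F k q) :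
    Form.pullback (F.map (faceArrow i s)) (prismEval F η q (face i s) θ α) =
      prismEval F η q s ((OrderHom.id.prodMap (coface i)).comp θ) α := by
  change Form.pullback _ (Form.pullback _ _) = Form.pullback _ _
  rw [← Form.pullback_comp, ← Functor.map_comp]
  -- The face arrow is viewed in the bottom slice of the prism, where it can be composed with
  -- `prismArrow` by functoriality.
  have h0 : faceArrow i s = (prism η s).map (Prod.mkHom (X₁ := (0 : Fin 2))
      (X₂ := (0 : Fin 2)) (Y₁ := (0 : Fin (p + 2))) (Y₂ := i.succAbove 0) (𝟙 _)
      (homOfLE (Fin.zero_le _))) := by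
    exact (Category.id_comp _).symm
  have : faceArrow i s ≫ prismArrow η (face i s) θ =
      prismArrow η s ((OrderHom.id.prodMap (coface i)).comp θ) := by
    rw [h0]
    exact ((prism η s).map_comp _ (Prod.mkHom (X₁ := (0 : Fin 2)) (X₂ := (θ 0).1)
      (Y₁ := i.succAbove 0) (Y₂ := i.succAbove (θ 0).2) (homOfLE (Fin.zero_le _))
      (homOfLE ((Fin.strictMono_succAbove i).monotone (Fin.zero_le _))))).symm
  rw [this]
  rfl

/-- The values at equal strings have different types, so they are compared through `eqToHom`. Since
`h0` is a separate argument, `rfl` can be supplied when the first objects agree by definition, and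
the transport becomes an identity. -/
lemma eval_eq_of_eq {p q : ℕ} (α : Cochain F p q) {s s' : ComposableArrows C p} (h : s = s')
    (h0 : s.obj 0 = s'.obj 0) : α s = Form.pullback (F.map (eqToHom h0)) (α s') := by
  subst h
  rw [eqToHom_refl, F.map_id, Form.pullback_id]

lemma pullback_eq_of_eq {p q : ℕ} (α : Cochain F p q) {V : C} {s s' : ComposableArrows C p}
    (h : s = s') (a : V ⟶ s.obj 0) (a' : V ⟶ s'.obj 0)
    (ha : a ≫ eqToHom (congrArg (fun t : ComposableArrows C p => t.obj 0) h) = a') :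
    Form.pullback (F.map a) (α s) = Form.pullback (F.map a') (α s') := by
  subst h
  rw [← ha, eqToHom_refl, Category.comp_id]

/-- The bottom end of the prism yields the identity in the homotopy formula; the top end, reached
through `η`, yields the pullback by `G`. -/
lemma prismEval_slice_zero {p q : ℕ} (s : ComposableArrows C p) (α : Cochain F p q) :
    prismEval F η q s (prismSlice p 0) α = α s := by
  have hs : prismString η s (prismSlice p 0) = s := CategoryTheory.Functor.hext (fun _ => rfl) fun i j f => by
    exact heq_of_eq (Category.id_comp _)
  refine (pullback_eq_of_eq F α hs _ (𝟙 (s.obj 0)) ?_).trans ?_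
  · exact (Category.comp_id _).trans ((Category.id_comp _).trans (s.map_id 0))
  · rw [F.map_id, Form.pullback_id]

lemma prismEval_slice_one {p q : ℕ} (s : ComposableArrows C p) (α : Cochain F p q) :
    prismEval F η q s (prismSlice p 1) α =
      cochainPullback G (spaceTrans F η) p q α s := by
  have hs : prismString η s (prismSlice p 1) = (s ⋙ G : Fin (p + 1) ⥤ C) :=
    CategoryTheory.Functor.hext (fun _ => rfl) fun i j f => by
      exact heq_of_eq (Category.id_comp _)
  refine pullback_eq_of_eq F α hs _ (η.app (s.obj 0)) ?_
  refine (Category.comp_id _).trans ?_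
  exact (congrArg (η.app (s.obj 0) ≫ ·) ((congrArg G.map (s.map_id 0)).trans
    (G.map_id _))).trans (Category.comp_id _)

lemma prismOperator_delta_zero {q : ℕ} (α : Cochain F 0 q) :
    prismOperator F η 0 q (delta F 0 q α) =
      cochainPullback G (spaceTrans F η) 0 q α - α := by
  funext s
  change _ = cochainPullback G (spaceTrans F η) 0 q α s - α s
  rw [← prismEval_slice_zero F η s α, ← prismEval_slice_one,
    ← sum_prism_zero fun θ => prismEval F η q s θ α, prismOperator_apply]
  simp only [prismEval_delta, Finset.smul_sum, smul_smul, pow_add]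

lemma prismOperator_delta_succ {p q : ℕ} (α : Cochain F (p + 1) q) :
    prismOperator F η (p + 1) q (delta F (p + 1) q α) + delta F p q (prismOperator F η p q α) =
      cochainPullback G (spaceTrans F η) (p + 1) q α - α := by
  funext s
  change prismOperator F η (p + 1) q (delta F (p + 1) q α) s +
    delta F p q (prismOperator F η p q α) s =
      cochainPullback G (spaceTrans F η) (p + 1) q α s - α s
  rw [← prismEval_slice_zero F η s α, ← prismEval_slice_one,
    ← sum_prism_succ fun θ => prismEval F η q s θ α, prismOperator_apply, delta_apply]
  simp only [prismOperator_apply, prismEval_delta, map_sum, map_smul, pullback_prismEval_face,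
    Finset.smul_sum, smul_smul, pow_add]

/-- The prism operator on total spaces. -/
def totPrism (m m' : ℕ) (h : m' + 1 = m) : Tot F m →ₗ[ℝ] Tot F m' :=
  Tot.lift F fun p q hpq => (prismOperator F η p q).comp (Tot.proj F m (p + 1) q (by omega))

lemma totPrism_totD_zero (α : Tot F 0) :
    totPrism F η 1 0 rfl (totD F 0 α) =
      totPullback G (spaceTrans F η) 0 α - α := by
  funext ⟨⟨p, q⟩, h⟩
  obtain ⟨rfl, rfl⟩ : p = 0 ∧ q = 0 := by omega
  -- The summand `0` is the vertical part of the `(1, 0)` component: nothing maps by `d` to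
  -- functions.
  change prismOperator F η 0 0 (delta F 0 0 (α ⟨(0, 0), h⟩) + 0) =
    cochainPullback G (spaceTrans F η) 0 0 (α ⟨(0, 0), h⟩) - α ⟨(0, 0), h⟩
  rw [add_zero (delta F 0 0 (α ⟨(0, 0), h⟩)), prismOperator_delta_zero]

/-- The prism operator commutes with `d` but lowers the Čech degree by one, so the signs
`(-1)^(p+1)` and `(-1)^p` cancel the two terms. Hence `totPrism` needs no sign of its own. -/
lemma prismOperator_vertical_add {m p q : ℕ} (h : p + q = m + 1) (α : Tot F (m + 1)) :
    prismOperator F η p q (vertical F (m + 1) (p + 1) q (by omega) α) +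
      vertical F m p q h (totPrism F η (m + 1) m rfl α) = 0 := by
  rcases q with - | q
  · exact (add_zero _).trans (map_zero _)
  · change prismOperator F η p (q + 1) (((-1 : ℝ) ^ (p + 1)) • deRham F (p + 1) q _) +
      ((-1 : ℝ) ^ p) • deRham F p q (prismOperator F η p q (α ⟨(p + 1, q), _⟩)) = 0
    rw [map_smul, ← prismOperator_deRham, pow_succ, mul_neg_one, neg_smul]
    exact neg_add_cancel _

lemma prismOperator_horizontal_add {m p q : ℕ} (h : p + q = m + 1) (α : Tot F (m + 1)) :
    prismOperator F η p q (horizontal F (m + 1) (p + 1) q (by omega) α) +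
      horizontal F m p q h (totPrism F η (m + 1) m rfl α) =
      cochainPullback G (spaceTrans F η) p q (α ⟨(p, q), h⟩) - α ⟨(p, q), h⟩ := by
  rcases p with - | p
  · exact (add_zero _).trans (prismOperator_delta_zero F η _)
  · exact prismOperator_delta_succ F η _

lemma totPrism_totD_succ (m : ℕ) (α : Tot F (m + 1)) :
    totPrism F η (m + 2) (m + 1) rfl (totD F (m + 1) α) +
        totD F m (totPrism F η (m + 1) m rfl α) =
      totPullback G (spaceTrans F η) (m + 1) α - α := by
  funext ⟨⟨p, q⟩, h⟩
  change prismOperator F η p q (horizontal F (m + 1) (p + 1) q _ α +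
      vertical F (m + 1) (p + 1) q _ α) +
    (horizontal F m p q h (totPrism F η (m + 1) m rfl α) +
      vertical F m p q h (totPrism F η (m + 1) m rfl α)) =
    cochainPullback G (spaceTrans F η) p q (α ⟨(p, q), h⟩) - α ⟨(p, q), h⟩
  rw [map_add, add_add_add_comm, prismOperator_horizontal_add, prismOperator_vertical_add,
    add_zero]

/-- A natural transformation `𝟭 C ⟶ G` makes the endomorphism of the Čech–de Rham complex
induced by `G` homotopic to the identity. -/
def cechDeRhamHomotopy :
    Homotopy (cechDeRhamMap G (spaceTrans F η)) (𝟙 (cechDeRham F)) :=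
  (Homotopy.equivSubZero).symm <| (Homotopy.ofEq <| by
    ext m : 1
    rcases m with - | m
    -- No differential enters degree `0`, so only the prism operator after `D` contributes.
    · refine Eq.trans ?_ (Homotopy.nullHomotopicMap'_f_of_not_rel_right (c := ComplexShape.up ℕ)
        (k₁ := 0) (k₀ := 1) rfl (fun l h => Nat.succ_ne_zero l h) _).symm
      simp only [cechDeRham]
      ext1
      exact LinearMap.ext fun α => (totPrism_totD_zero F η α).symm
    · refine Eq.trans ?_ (Homotopy.nullHomotopicMap'_f (c := ComplexShape.up ℕ)
        (k₂ := m) (k₁ := m + 1) (k₀ := m + 1 + 1) rfl rfl _).symm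
      simp only [cechDeRham, CochainComplex.of_d]
      ext1
      exact LinearMap.ext fun α => (totPrism_totD_succ F η m α).symm).trans
  (Homotopy.nullHomotopy' fun i j h =>
    (ModuleCat.ofHom (totPrism F η i j h) : (cechDeRham F).X i ⟶ (cechDeRham F).X j))

end Homotopy

/-! ### Comparison of the cover `𝒰_Q` with the complete cover -/

namespace Atlas.Cover

variable {n : ℕ} {X : Type u} {A : Atlas n X} {𝒰 : A.Cover} {Q : FrameType}

namespace CompleteFrameCover

variable (B : 𝒰.CompleteFrameCover Q)

/-- The inclusions `V ⊆ Q(U)` of the elements of the complete cover. -/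
def unit : 𝟭 B.Obj ⟶ B.baseFunctor ⋙ B.inclusion where
  app V := ⟨PlotSpace.restrictMap (𝟙 (Q.space V.base.set)) V.set ⊤ fun _ _ => trivial, 𝟙 V.base,
    fun x => (congrFun (congrArg PlotSpace.Map.toFun
      ((Q.functor n).map_id ⟨V.base.set⟩)) x.1).symm⟩
  naturality _ _ g := Subtype.ext <| PlotSpace.Map.ext <| funext fun x => Subtype.ext <|
    B.map_baseArrow g x

/-- Both sides evaluate a cochain on the `G`-image of the string and restrict the form to `V₀`. This
puts `μ ∘ λ` in the form to which the prism homotopy applies. -/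
lemma restriction_comp_extension :
    B.restriction ≫ B.extension =
      cechDeRhamMap (B.baseFunctor ⋙ B.inclusion) (spaceTrans B.diagram B.unit) := by
  rfl

/-- `baseArrow` is chosen, but `p(V) = U` makes the choice unique, so it recovers `h` from `Q(h)`.
-/
lemma inclusion_comp_baseFunctor : B.inclusion ⋙ B.baseFunctor = 𝟭 𝒰.Obj :=
  CategoryTheory.Functor.hext (fun _ => rfl) fun U U' h => by
    have : B.baseArrow (B.inclusion.map h) = h := B.baseArrow_eq _ _ fun _ => rfl
    exact heq_of_eq this

lemma extension_comp_restriction :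
    B.extension ≫ B.restriction = 𝟙 (cechDeRham (𝒰.frameCover Q)) := by
  ext m : 1
  ext1
  refine LinearMap.ext fun α => funext fun x => funext fun s => ?_
  -- The objects of the two strings agree by definition, the arrows only by uniqueness of `h`; hence
  -- the detour through `eval_eq_of_eq`.
  have hs : (s ⋙ (B.inclusion ⋙ B.baseFunctor) : Fin (x.1.1 + 1) ⥤ 𝒰.Obj) = s := by
    rw [B.inclusion_comp_baseFunctor]
    rfl
  refine (eval_eq_of_eq (𝒰.frameCover Q) (α x) hs rfl).trans ?_
  change Form.pullback ((𝒰.frameCover Q).map (𝟙 (s.obj 0))) (α x s) = α x s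
  rw [(𝒰.frameCover Q).map_id, Form.pullback_id]

/-- The restriction and the extension of cochains are inverse homotopy equivalences. -/
def homotopyEquiv : HomotopyEquiv (cechDeRham (𝒰.frameCover Q)) (cechDeRham B.diagram) where
  hom := B.extension
  inv := B.restriction
  homotopyHomInvId := Homotopy.ofEq B.extension_comp_restriction
  homotopyInvHomId := (Homotopy.ofEq B.restriction_comp_extension).trans
    (cechDeRhamHomotopy B.diagram B.unit)

end CompleteFrameCover

/-! ### Naturality in `X` -/

namespace IsCompatible

variable {Y : Type u} {A' : Atlas n Y} {f : X → Y} {𝒰' : A'.Cover} (hf : IsCompatible f 𝒰 𝒰')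
  {B : 𝒰.CompleteFrameCover Q} {B' : 𝒰'.CompleteFrameCover Q}
  (hB : ∀ U : 𝒰.Obj, B.sets U ⊆ B'.sets (hf.functor.obj U))

/-- The arrow below `g` over `X`, moved to `Y`, still restricts to `g`; by uniqueness it is the
arrow below the image of `g`. -/
lemma completeFunctor_comp_baseFunctor :
    hf.completeFunctor hB ⋙ B'.baseFunctor = B.baseFunctor ⋙ hf.functor :=
  CategoryTheory.Functor.hext (fun _ => rfl) fun V V' g => by
    have : B'.baseArrow ((hf.completeFunctor hB).map g) = hf.functor.map (B.baseArrow g) :=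
      B'.baseArrow_eq _ _ (B.map_baseArrow g)
    exact heq_of_eq this

lemma extension_comp_completePullback :
    B'.extension ≫ hf.completePullback hB = hf.pullback Q ≫ B.extension := by
  ext m : 1
  ext1
  refine LinearMap.ext fun α => funext fun x => funext fun s => ?_
  have hs : (s ⋙ (hf.completeFunctor hB ⋙ B'.baseFunctor) : Fin (x.1.1 + 1) ⥤ 𝒰'.Obj) =
      (s ⋙ (B.baseFunctor ⋙ hf.functor) : Fin (x.1.1 + 1) ⥤ 𝒰'.Obj) := by
    rw [hf.completeFunctor_comp_baseFunctor hB]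
  -- Both sides restrict to `V₀` the value of `α` on a string of `𝒰'`; these strings are equal by
  -- `hs` and start at the same object by definition.
  refine congrArg (Form.pullback ((Q.space (s.obj 0).base.set).inclusion (s.obj 0).set))
    ((eval_eq_of_eq (𝒰'.frameCover Q) (α x) hs rfl).trans ?_)
  exact congrArg (fun u => Form.pullback u (α x _))
    ((𝒰'.frameCover Q).map_id (hf.functor.obj (s.obj 0).base))

end IsCompatible

end Atlas.Cover

end CechDeRham

end

theorem mainTheorem8 (n : ℕ) (Q : CechDeRham.FrameType) :
    (∀ {X : Type u} (A : CechDeRham.Atlas n X) (_ : A.IsFull) (𝒰 : A.Cover)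
      (B : 𝒰.CompleteFrameCover Q) (m : ℕ),
      ∃ e : CechDeRham.cechDeRhamCohomology (𝒰.frameCover Q) m ≅
          CechDeRham.cechDeRhamCohomology B.diagram m,
        e.hom = HomologicalComplex.homologyMap B.extension m ∧
        e.inv = HomologicalComplex.homologyMap B.restriction m) ∧
    (∀ {X Y : Type u} (A : CechDeRham.Atlas n X) (_ : A.IsFull) (A' : CechDeRham.Atlas n Y)
      (_ : A'.IsFull) (𝒰 : A.Cover) (𝒰' : A'.Cover) (B : 𝒰.CompleteFrameCover Q)
      (B' : 𝒰'.CompleteFrameCover Q) (f : X → Y)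
      (hf : CechDeRham.Atlas.Cover.IsCompatible f 𝒰 𝒰')
      (hB : ∀ U : 𝒰.Obj, B.sets U ⊆ B'.sets (hf.functor.obj U)) (m : ℕ),
      HomologicalComplex.homologyMap B'.extension m ≫
          HomologicalComplex.homologyMap (hf.completePullback hB) m =
        HomologicalComplex.homologyMap (hf.pullback Q) m ≫
          HomologicalComplex.homologyMap B.extension m) := by
  refine ⟨fun A _ 𝒰 B m => ⟨B.homotopyEquiv.toHomologyIso m, rfl, rfl⟩, ?_⟩
  intro X Y A _ A' _ 𝒰 𝒰' B B' f hf hB m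
  rw [← HomologicalComplex.homologyMap_comp, ← HomologicalComplex.homologyMap_comp,
    hf.extension_comp_completePullback hB]
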